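/- Let $a>b>0$ and put $p=\sqrt{a^2+b^2}$, $r=\sqrt{a^2-b^2}$. Let $P^6\subset\mathbb R^9(\omega,\alpha,\beta)$, where $\omega,\alpha,\beta\in\mathbb R^3$, be the manifold $|\alpha|^2=a^2$, $|\beta|^2=b^2$, $\alpha\cdot\beta=0$, let $\gamma=\alpha\times\beta$, and let $J=(H,K,G):P^6\to\mathbb R^3(h,k,g)$ be the map given by $$H=\omega_1^2+\omega_2^2+\tfrac12\omega_3^2-(\alpha_1+\beta_2),$$ $$K=(\omega_1^2-\omega_2^2+\alpha_1-\beta_2)^2+(2\omega_1\omega_2+\alpha_2+\beta_1)^2,$$ $$G=(\alpha_1\omega_1+\alpha_2\omega_2+\tfrac12\alpha_3\omega_3)^2+(\beta_1\omega_1+\beta_2\omega_2+\tfrac12\beta_3\omega_3)^2+\omega_3(\gamma_1\omega_1+\gamma_2\omega_2+\tfrac12\gamma_3\omega_3)-\alpha_1b^2-\beta_2a^2.$$ Let $\Sigma=J(\{\zeta\in P^6:\operatorname{rank}dJ(\zeta)<3\})$ be the bifurcation diagram (the set of critical values) of $J$, let $\Sigma_2=\{(h,k,g):(2g-p^2h)^2-r^4k=0\}$,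 and for $h\ge\sqrt2\,p$ let $$g_\pm(h)=\frac1{4p^2}\Bigl[(2p^4-r^4)h\pm r^4\sqrt{h^2-2p^2}\Bigr].$$ Then $\Sigma_2\cap\Sigma$ lies in the half-space $h\ge-(a+b)$, and a point $(h,k,g)$ of $\Sigma_2$ belongs to $\Sigma$ if and only if at least one of the following three systems of inequalities holds: (i) $-(a+b)\le h\le\sqrt2\,p$ and $b^2h-br^2\le g\le a^2h+ar^2$; (ii) $h\ge\sqrt2\,p$ and $b^2h-br^2\le g\le g_-(h)$; (iii) $h\ge\sqrt2\,p$ and $g_+(h)\le g\le a^2h+ar^2$. In particular, no point of $\Sigma_2\cap\Sigma$ has $h\ge\sqrt2\,p$ and $g_-(h)<g<g_+(h)$. -/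

import Mathlib

namespace KowalevskiTop

/-- Vectors of `ℝ³`, written by their components in the moving axes
(index `0, 1, 2` stands for the first, second, third axis). -/
abbrev Vec3 : Type := Fin 3 → ℝ

/-- The space `ℝ⁹` of triples `(ω, α, β)`: the angular velocity and the two
characteristic vectors of the force fields. -/
abbrev Ambient : Type := Vec3 × Vec3 × Vec3

/-- The geometric integrals `(α · α, β · β, α · β)`. -/
noncomputable def geom (ζ : Ambient) : ℝ × ℝ × ℝ :=
  let α := ζ.2.1
  let β := ζ.2.2
  (α ⬝ᵥ α, β ⬝ᵥ β, α ⬝ᵥ β)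

/-- The phase space `P⁶ ⊂ ℝ⁹`, given by `|α|² = a²`, `|β|² = b²`, `α · β = 0`. -/
def P6 (a b : ℝ) : Set Ambient := {ζ | geom ζ = (a ^ 2, b ^ 2, 0)}

/-- The energy integral. -/
noncomputable def H (ζ : Ambient) : ℝ :=
  let ω := ζ.1
  let α := ζ.2.1
  let β := ζ.2.2
  ω 0 ^ 2 + ω 1 ^ 2 + 1 / 2 * ω 2 ^ 2 - (α 0 + β 1)

/-- The generalized Kowalevski integral. -/
noncomputable def K (ζ : Ambient) : ℝ :=
  let ω := ζ.1
  let α := ζ.2.1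
  let β := ζ.2.2
  (ω 0 ^ 2 - ω 1 ^ 2 + α 0 - β 1) ^ 2 + (2 * ω 0 * ω 1 + α 1 + β 0) ^ 2

/-- The third integral; here `γ = α × β`. -/
noncomputable def G (a b : ℝ) (ζ : Ambient) : ℝ :=
  let ω := ζ.1
  let α := ζ.2.1
  let β := ζ.2.2
  let γ := crossProduct α β
  (α 0 * ω 0 + α 1 * ω 1 + 1 / 2 * α 2 * ω 2) ^ 2
    + (β 0 * ω 0 + β 1 * ω 1 + 1 / 2 * β 2 * ω 2) ^ 2
    + ω 2 * (γ 0 * ω 0 + γ 1 * ω 1 + 1 / 2 * γ 2 * ω 2)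
    - α 0 * b ^ 2 - β 1 * a ^ 2

/-- The integral map `J = H × K × G`; its values are triples `(h, k, g)`. -/
noncomputable def J (a b : ℝ) (ζ : Ambient) : ℝ × ℝ × ℝ := (H ζ, K ζ, G a b ζ)

/-- The tangent space of the level set of `geom` through `ζ`: for `ζ ∈ P6 a b` with
`a, b > 0` it is the tangent space of the submanifold `P⁶` at `ζ`. -/
noncomputable def tangentP6 (ζ : Ambient) : Submodule ℝ Ambient :=
  (fderiv ℝ geom ζ).toLinearMap.ker

/-- The rank at `ζ` of the differential of the map `J` restricted to `P⁶`. -/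
noncomputable def rankJ (a b : ℝ) (ζ : Ambient) : ℕ :=
  Module.finrank ℝ ((tangentP6 ζ).map (fderiv ℝ (J a b) ζ).toLinearMap)

/-- The set `c(J)` of critical points of `J : P⁶ → ℝ³`. -/
def criticalSet (a b : ℝ) : Set Ambient := {ζ | ζ ∈ P6 a b ∧ rankJ a b ζ < 3}

/-- The bifurcation diagram `Σ = Σ(J)`, the set of critical values of `J : P⁶ → ℝ³`. -/
def bifurcationDiagram (a b : ℝ) : Set (ℝ × ℝ × ℝ) := J a b '' criticalSet a b

/-- `p = √(a² + b²)`. -/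
noncomputable def p (a b : ℝ) : ℝ := √(a ^ 2 + b ^ 2)

/-- `r = √(a² - b²)`. -/
noncomputable def r (a b : ℝ) : ℝ := √(a ^ 2 - b ^ 2)

/-- The surface `Σ₂ = {(2g - p²h)² - r⁴k = 0}` in the space of `(h, k, g)`. -/
def surface2 (a b : ℝ) : Set (ℝ × ℝ × ℝ) :=
  {(h, k, g) : ℝ × ℝ × ℝ | (2 * g - p a b ^ 2 * h) ^ 2 - r a b ^ 4 * k = 0}

/-- The upper branch `g₊(h)`, meaningful for `h ≥ √2 p`. -/
noncomputable def gPlus (a b h : ℝ) : ℝ :=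
  1 / (4 * p a b ^ 2) *
    ((2 * p a b ^ 4 - r a b ^ 4) * h + r a b ^ 4 * √(h ^ 2 - 2 * p a b ^ 2))

/-- The lower branch `g₋(h)`, meaningful for `h ≥ √2 p`. -/
noncomputable def gMinus (a b h : ℝ) : ℝ :=
  1 / (4 * p a b ^ 2) *
    ((2 * p a b ^ 4 - r a b ^ 4) * h - r a b ^ 4 * √(h ^ 2 - 2 * p a b ^ 2))

end KowalevskiTop

/-!
The proof uses the complex coordinates `w = ω₁ + iω₂`, `x = (α₁ - β₂) + i(α₂ + β₁)`,
`y = (α₁ + β₂) + i(α₂ - β₁)`, `z = α₃ + iβ₃` and the real coordinate `t = ω₃`. In these, `P⁶` is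
`x ȳ + z² = r²`, `|x|² + |y|² + 2|z|² = 2p²`, the integrals are `H = |w|² + t²/2 - Re y` and
`K = |w² + x|²`, and on `P⁶` one has (`normSq_cx_mul`)
`|x|² (2G - p²H) = -F²/2 + r² Re (x̄² (w² + x))` with `F = |x|² t - 2 Re (x̄ z w)`.

A point of `Σ₂` is written as `2g - p²h = r²s`, `k = s²`, `s = r²m`. It is a critical value
if and only if (`mem_bifurcationDiagram_iff`)
`-(a + b) ≤ h`, `s ≤ h + 2a`, `-s ≤ h + 2b` and `0 ≤ 2p²m² + 2hm + 1`.
The second and third inequalities are the lines bounding `g`; the quadratic has real roots in `m`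
exactly for `h² ≥ 2p²`, and then its roots correspond to the branches `g₊` and `g₋`.

*Necessity.* The bounds `|x| + |y| ≤ 2a` and `|y| ≤ |x| + 2b`, valid on `P⁶`, give `H ≥ -(a + b)`,
`√K ≤ H + 2a` and `-√K ≤ H + 2b`. They settle the case `s = √K`. Let `s = -√K`. When `x ≠ 0`, put
`ϑ = x / |x|`, `w = ϑ v`, `ρ = |x|`, and choose a square root `u` of `v² + x̄`, so that `√K = |u|²`.
The equation `2G - p²H = -r²√K` now factors as `ρt = r(u + ū) + zv + z̄v̄` (structure `Sep`), and
with `q = zu + rv`,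
`ρ² (H - |u|²) = -Re M + 2 (Re q)²`, `ρ² (H + |u|²) = M' - 2 (Im q)²`,
where `|M| = 2bρ²`, and `M'` is half the sum of two factors with product `4a²ρ⁴`. The first formula
gives `|u|² ≤ H + 2b` (`Sep.kappa_le`). For the quadratic: if `Re u = 0`, it is a square divided by
`ρ²`. If not, then apart from a trivial case with `w = z = 0` the Lagrange equations at a critical
point yield a real `c` with `c q = q̄`, hence `q` is real, or purely imaginary, or zero, and in each
case `(H + |u|²)² = 4a²` or `(H - |u|²)² = 4b²`; either relation makes the quadratic a perfect
square. The locus `x = 0` is handled directly.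

*Sufficiency.* Where `F = 0` and `x̄ (w² + x) = s x`, the differentials of `2s (2G - p²H)` and `r²K`
agree on the tangent space of `P⁶`, so the point is critical, and lies over `Σ₂`. Such points are
parametrised by two quantities `A ≥ 2a` and `B ∈ [-2b, 2b]` (separated variables). For `m ≠ 0` and
`ℓ² = 2p²m² + 2hm + 1` the remaining requirement is that one of `ℓ - mA`, `ℓ - mB` lies in
`[-1, 1]` and the other outside `(-1, 1)`, their sum being nonnegative. The four inequalities allow
such a choice of `A` and `B`; the case `m = 0` is simpler.
-/

namespace KowalevskiTop

open ComplexConjugate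

/-! ### Complex coordinates on the phase space -/

/-- The complex coordinate `ω₁ + iω₂`. -/
noncomputable def cw (ζ : Ambient) : ℂ := ⟨ζ.1 0, ζ.1 1⟩
/-- The complex coordinate `(α₁ - β₂) + i(α₂ + β₁)`. -/
noncomputable def cx (ζ : Ambient) : ℂ := ⟨ζ.2.1 0 - ζ.2.2 1, ζ.2.1 1 + ζ.2.2 0⟩
/-- The complex coordinate `(α₁ + β₂) + i(α₂ - β₁)`. -/
noncomputable def cy (ζ : Ambient) : ℂ := ⟨ζ.2.1 0 + ζ.2.2 1, ζ.2.1 1 - ζ.2.2 0⟩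
/-- The complex coordinate `α₃ + iβ₃`. -/
noncomputable def cz (ζ : Ambient) : ℂ := ⟨ζ.2.1 2, ζ.2.2 2⟩

/-- The point of `ℝ⁹` with complex coordinates `w`, `x`, `y`, `z` and third component `t` of `ω`.
It also serves to write tangent vectors, the coordinates being linear. -/
noncomputable def ofComplex (w : ℂ) (t : ℝ) (x y z : ℂ) : Ambient :=
  (![w.re, w.im, t], ![(x.re + y.re) / 2, (x.im + y.im) / 2, z.re],
    ![(x.im - y.im) / 2, (y.re - x.re) / 2, z.im])

section ofComplex
variable (w : ℂ) (t : ℝ) (x y z : ℂ)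

@[simp] lemma cw_ofComplex : cw (ofComplex w t x y z) = w := by
  apply Complex.ext <;> simp [cw, ofComplex]
@[simp] lemma ofComplex_two : (ofComplex w t x y z).1 2 = t := by simp [ofComplex]
@[simp] lemma cx_ofComplex : cx (ofComplex w t x y z) = x := by
  apply Complex.ext <;> simp [cx, ofComplex] <;> ring
@[simp] lemma cy_ofComplex : cy (ofComplex w t x y z) = y := by
  apply Complex.ext <;> simp [cy, ofComplex] <;> ring
@[simp] lemma cz_ofComplex : cz (ofComplex w t x y z) = z := by
  apply Complex.ext <;> simp [cz, ofComplex]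
end ofComplex

lemma H_eq (ζ : Ambient) :
    (H ζ : ℂ) = cw ζ * conj (cw ζ) + (ζ.1 2 : ℂ) ^ 2 / 2 - (cy ζ + conj (cy ζ)) / 2 := by
  apply Complex.ext <;> simp [H, cw, cy, pow_two] <;> ring

lemma K_eq (ζ : Ambient) :
    (K ζ : ℂ) = (cw ζ ^ 2 + cx ζ) * conj (cw ζ ^ 2 + cx ζ) := by
  apply Complex.ext <;> simp [K, cw, cx, pow_two] <;> ring

lemma G_eq (a b : ℝ) (ζ : Ambient) :
    (G a b ζ : ℂ) =
      (conj (cx ζ) * cw ζ + cy ζ * conj (cw ζ)) * (cx ζ * conj (cw ζ) + conj (cy ζ) * cw ζ) / 4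
      + ζ.1 2 * (conj (cx ζ) * cz ζ * cw ζ + cx ζ * conj (cz ζ) * conj (cw ζ)) / 2
      + (ζ.1 2 : ℂ) ^ 2 / 8 *
        (2 * (cz ζ * conj (cz ζ)) + cy ζ * conj (cy ζ) - cx ζ * conj (cx ζ))
      - ((a : ℂ) ^ 2 + b ^ 2) / 4 * (cy ζ + conj (cy ζ))
      + ((a : ℂ) ^ 2 - b ^ 2) / 4 * (cx ζ + conj (cx ζ)) := by
  apply Complex.ext <;>
    simp [G, cw, cx, cy, cz, pow_two, crossProduct] <;> ring

/-- The three real equations of `P⁶`: `x ȳ + z² = a² - b²` is `|α|² - |β|² = a² - b²` together with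
`α · β = 0`, and the second equation is `|α|² + |β|² = a² + b²`. -/
lemma mem_P6_iff {a b : ℝ} {ζ : Ambient} :
    ζ ∈ P6 a b ↔
      cx ζ * conj (cy ζ) + cz ζ ^ 2 = (a : ℂ) ^ 2 - b ^ 2 ∧
      cx ζ * conj (cx ζ) + cy ζ * conj (cy ζ) + 2 * (cz ζ * conj (cz ζ)) =
        2 * ((a : ℂ) ^ 2 + b ^ 2) := by
  simp only [P6, geom, Set.mem_ofPred_eq, Prod.mk.injEq, Complex.ext_iff]
  simp [cx, cy, cz, pow_two, dotProduct, Fin.sum_univ_three]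
  constructor
  · rintro ⟨h1, h2, h3⟩
    refine ⟨⟨?_, ?_⟩, ?_, ?_⟩ <;> linarith
  · rintro ⟨⟨h1, h2⟩, h3, h4⟩
    refine ⟨?_, ?_, ?_⟩ <;> linarith

section line

variable (ζ δ : Ambient)

lemma hasDerivAt_linear (z d : ℂ) : HasDerivAt (fun t : ℝ => z + t * d) d 0 := by
  simpa using ((Complex.ofRealCLM.hasDerivAt (x := (0 : ℝ))).mul_const d).const_add z

lemma cw_line (t : ℝ) : cw (ζ + t • δ) = cw ζ + t * cw δ := by
  apply Complex.ext <;> simp [cw]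
lemma cx_line (t : ℝ) : cx (ζ + t • δ) = cx ζ + t * cx δ := by
  apply Complex.ext <;> simp [cx] <;> ring
lemma cy_line (t : ℝ) : cy (ζ + t • δ) = cy ζ + t * cy δ := by
  apply Complex.ext <;> simp [cy] <;> ring
lemma cz_line (t : ℝ) : cz (ζ + t • δ) = cz ζ + t * cz δ := by
  apply Complex.ext <;> simp [cz]

lemma differentiable_H : Differentiable ℝ H := by unfold H; fun_prop
lemma differentiable_K : Differentiable ℝ K := by unfold K; fun_prop
lemma differentiable_G (a b : ℝ) : Differentiable ℝ (G a b) := by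
  have : G a b = fun ζ : Ambient =>
     (ζ.2.1 0 * ζ.1 0 + ζ.2.1 1 * ζ.1 1 + 1 / 2 * ζ.2.1 2 * ζ.1 2) ^ 2
    + (ζ.2.2 0 * ζ.1 0 + ζ.2.2 1 * ζ.1 1 + 1 / 2 * ζ.2.2 2 * ζ.1 2) ^ 2
    + ζ.1 2 * ((ζ.2.1 1 * ζ.2.2 2 - ζ.2.1 2 * ζ.2.2 1) * ζ.1 0
      + (ζ.2.1 2 * ζ.2.2 0 - ζ.2.1 0 * ζ.2.2 2) * ζ.1 1
      + 1 / 2 * (ζ.2.1 0 * ζ.2.2 1 - ζ.2.1 1 * ζ.2.2 0) * ζ.1 2)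
    - ζ.2.1 0 * b ^ 2 - ζ.2.2 1 * a ^ 2 := by
    ext ζ; simp [G, crossProduct]
  rw [this]; fun_prop
lemma differentiable_geom : Differentiable ℝ geom := by
  unfold geom dotProduct; simp only [Fin.sum_univ_three]; fun_prop

/-- Differentials are computed as derivatives along lines, so that the formulas in complex
coordinates can be differentiated in one real variable. -/
lemma hasDerivAt_line {E : Type*} [NormedAddCommGroup E] [NormedSpace ℝ E] {f : Ambient → E}
    (hf : Differentiable ℝ f) :
    HasDerivAt (fun t : ℝ => f (ζ + t • δ)) (fderiv ℝ f ζ δ) 0 := by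
  have h := (hf ζ).hasFDerivAt
  have h2 : HasDerivAt (fun t : ℝ => ζ + t • δ) δ 0 := by
    simpa using ((hasDerivAt_id (0 : ℝ)).smul_const δ).const_add ζ
  have h3 : HasFDerivAt f (fderiv ℝ f ζ) (ζ + (0 : ℝ) • δ) := by simpa using h
  exact h3.comp_hasDerivAt (0 : ℝ) h2

lemma hasDerivAt_line_ofReal {f : Ambient → ℝ} (hf : Differentiable ℝ f) :
    HasDerivAt (fun t : ℝ => (f (ζ + t • δ) : ℂ)) (fderiv ℝ f ζ δ : ℂ) 0 :=
  (hasDerivAt_line ζ δ hf).ofReal_comp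

lemma fderiv_H : (fderiv ℝ H ζ δ : ℂ) =
    cw δ * conj (cw ζ) + cw ζ * conj (cw δ) + ζ.1 2 * δ.1 2 - (cy δ + conj (cy δ)) / 2 := by
  refine (hasDerivAt_line_ofReal ζ δ differentiable_H).unique ?_
  simp only [H_eq, cw_line, cy_line, map_add, map_mul, Complex.conj_ofReal]
  have hw := hasDerivAt_linear (cw ζ) (cw δ)
  have hw' := hasDerivAt_linear (conj (cw ζ)) (conj (cw δ))
  have hy := hasDerivAt_linear (cy ζ) (cy δ)
  have hy' := hasDerivAt_linear (conj (cy ζ)) (conj (cy δ))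
  have ht := hasDerivAt_linear (ζ.1 2) (δ.1 2)
  convert ((hw.mul hw').add ((ht.pow 2).div_const 2)).sub ((hy.add hy').div_const 2) using 1
  · ext t; simp
  · simp; ring

lemma fderiv_K : (fderiv ℝ K ζ δ : ℂ) =
    (2 * cw ζ * cw δ + cx δ) * conj (cw ζ ^ 2 + cx ζ)
      + (cw ζ ^ 2 + cx ζ) * conj (2 * cw ζ * cw δ + cx δ) := by
  refine (hasDerivAt_line_ofReal ζ δ differentiable_K).unique ?_
  simp only [K_eq, cw_line, cx_line, map_add, map_mul, map_pow, Complex.conj_ofReal]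
  have hw := hasDerivAt_linear (cw ζ) (cw δ)
  have hw' := hasDerivAt_linear (conj (cw ζ)) (conj (cw δ))
  have hx := hasDerivAt_linear (cx ζ) (cx δ)
  have hx' := hasDerivAt_linear (conj (cx ζ)) (conj (cx δ))
  exact (((hw.pow 2).add hx).mul ((hw'.pow 2).add hx')).congr_deriv
    (by simp [map_ofNat (starRingEnd ℂ) 2])

lemma fderiv_G (a b : ℝ) : (fderiv ℝ (G a b) ζ δ : ℂ) =
      ((conj (cx δ) * cw ζ + cy δ * conj (cw ζ) + conj (cx ζ) * cw δ + cy ζ * conj (cw δ))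
          * (cx ζ * conj (cw ζ) + conj (cy ζ) * cw ζ)
        + (conj (cx ζ) * cw ζ + cy ζ * conj (cw ζ))
          * (cx δ * conj (cw ζ) + conj (cy δ) * cw ζ + cx ζ * conj (cw δ) + conj (cy ζ) * cw δ)) / 4
      + δ.1 2 * (conj (cx ζ) * cz ζ * cw ζ + cx ζ * conj (cz ζ) * conj (cw ζ)) / 2
      + ζ.1 2 * (conj (cx δ) * cz ζ * cw ζ + cx δ * conj (cz ζ) * conj (cw ζ)
        + conj (cx ζ) * cz δ * cw ζ + cx ζ * conj (cz δ) * conj (cw ζ)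
        + conj (cx ζ) * cz ζ * cw δ + cx ζ * conj (cz ζ) * conj (cw δ)) / 2
      + ζ.1 2 * δ.1 2 / 4 *
        (2 * (cz ζ * conj (cz ζ)) + cy ζ * conj (cy ζ) - cx ζ * conj (cx ζ))
      + (ζ.1 2 : ℂ) ^ 2 / 8 *
        (2 * (cz δ * conj (cz ζ) + cz ζ * conj (cz δ)) + cy δ * conj (cy ζ) + cy ζ * conj (cy δ)
          - cx δ * conj (cx ζ) - cx ζ * conj (cx δ))
      - ((a : ℂ) ^ 2 + b ^ 2) / 4 * (cy δ + conj (cy δ))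
      + ((a : ℂ) ^ 2 - b ^ 2) / 4 * (cx δ + conj (cx δ)) := by
  refine (hasDerivAt_line_ofReal ζ δ (differentiable_G a b)).unique ?_
  simp only [G_eq, cw_line, cx_line, cy_line, cz_line, map_add, map_mul, Complex.conj_ofReal]
  have hw := hasDerivAt_linear (cw ζ) (cw δ)
  have hw' := hasDerivAt_linear (conj (cw ζ)) (conj (cw δ))
  have hx := hasDerivAt_linear (cx ζ) (cx δ)
  have hx' := hasDerivAt_linear (conj (cx ζ)) (conj (cx δ))
  have hy := hasDerivAt_linear (cy ζ) (cy δ)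
  have hy' := hasDerivAt_linear (conj (cy ζ)) (conj (cy δ))
  have hz := hasDerivAt_linear (cz ζ) (cz δ)
  have hz' := hasDerivAt_linear (conj (cz ζ)) (conj (cz δ))
  have ht := hasDerivAt_linear (ζ.1 2) (δ.1 2)
  convert (((((((hx'.mul hw).add (hy.mul hw')).mul ((hx.mul hw').add (hy'.mul hw))).div_const 4).add
    ((ht.mul (((hx'.mul hz).mul hw).add ((hx.mul hz').mul hw'))).div_const 2)).add
    (((ht.pow 2).div_const 8).mul ((((hz.mul hz').const_mul 2).add (hy.mul hy')).sub
      (hx.mul hx')))).sub ((hy.add hy').const_mul (((a : ℂ) ^ 2 + b ^ 2) / 4))).add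
    ((hx.add hx').const_mul (((a : ℂ) ^ 2 - b ^ 2) / 4)) using 1
  · ext t; simp
  · simp; ring

lemma mem_tangentP6_iff : δ ∈ tangentP6 ζ ↔
    cx δ * conj (cy ζ) + cx ζ * conj (cy δ) + 2 * cz ζ * cz δ = 0 ∧
    cx δ * conj (cx ζ) + cx ζ * conj (cx δ) + cy δ * conj (cy ζ) + cy ζ * conj (cy δ)
      + 2 * (cz δ * conj (cz ζ) + cz ζ * conj (cz δ)) = 0 := by
  have h : fderiv ℝ geom ζ δ = (2 * (ζ.2.1 ⬝ᵥ δ.2.1), 2 * (ζ.2.2 ⬝ᵥ δ.2.2),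
      ζ.2.1 ⬝ᵥ δ.2.2 + ζ.2.2 ⬝ᵥ δ.2.1) := by
    refine (hasDerivAt_line ζ δ differentiable_geom).unique ?_
    have hl : ∀ p q : ℝ, HasDerivAt (fun t : ℝ => p + t * q) q 0 := fun p q => by
      simpa using ((hasDerivAt_id (0 : ℝ)).mul_const q).const_add p
    have hd : ∀ p q p' q' : Vec3, HasDerivAt (fun t : ℝ => (p + t • q) ⬝ᵥ (p' + t • q'))
        (p ⬝ᵥ q' + p' ⬝ᵥ q) 0 := by
      intro p q p' q'
      simp only [dotProduct, Fin.sum_univ_three, Pi.add_apply, Pi.smul_apply, smul_eq_mul]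
      exact ((((hl (p 0) (q 0)).mul (hl (p' 0) (q' 0))).add
        ((hl (p 1) (q 1)).mul (hl (p' 1) (q' 1)))).add
        ((hl (p 2) (q 2)).mul (hl (p' 2) (q' 2)))).congr_deriv (by simp; ring)
    have h1 := hd ζ.2.1 δ.2.1 ζ.2.1 δ.2.1
    have h2 := hd ζ.2.2 δ.2.2 ζ.2.2 δ.2.2
    have h3 := hd ζ.2.1 δ.2.1 ζ.2.2 δ.2.2
    rw [← two_mul] at h1 h2
    exact h1.prodMk (h2.prodMk h3)
  rw [tangentP6, LinearMap.mem_ker, ContinuousLinearMap.coe_coe, h]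
  simp only [Prod.mk_eq_zero, Complex.ext_iff]
  simp [cx, cy, cz, dotProduct, Fin.sum_univ_three]
  constructor
  · rintro ⟨h1, h2, h3⟩
    refine ⟨⟨?_, ?_⟩, ?_, ?_⟩ <;> linarith
  · rintro ⟨⟨h1, h2⟩, h3, h4⟩
    refine ⟨?_, ?_, ?_⟩ <;> linarith

lemma fderiv_J (a b : ℝ) : fderiv ℝ (J a b) ζ δ =
    (fderiv ℝ H ζ δ, fderiv ℝ K ζ δ, fderiv ℝ (G a b) ζ δ) := by
  have h1 := (differentiable_H ζ).hasFDerivAt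
  have h2 := (differentiable_K ζ).hasFDerivAt
  have h3 := (differentiable_G a b ζ).hasFDerivAt
  have : fderiv ℝ (J a b) ζ = _ := (h1.prodMk (h2.prodMk h3)).fderiv
  rw [this]; rfl

end line

/-- Criticality as a Lagrange condition. The multiplier `c₃` is attached to `2G - p²H`, which has a
simpler expression than `G`. -/
lemma rankJ_lt_three_iff {a b : ℝ} {ζ : Ambient} :
    rankJ a b ζ < 3 ↔ ∃ c₁ c₂ c₃ : ℝ, (c₁ ≠ 0 ∨ c₂ ≠ 0 ∨ c₃ ≠ 0) ∧
      ∀ δ ∈ tangentP6 ζ, c₁ * fderiv ℝ H ζ δ + c₂ * fderiv ℝ K ζ δ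
        + c₃ * (2 * fderiv ℝ (G a b) ζ δ - (a ^ 2 + b ^ 2) * fderiv ℝ H ζ δ) = 0 := by
  have h3 : Module.finrank ℝ (ℝ × ℝ × ℝ) = 3 := by simp
  unfold rankJ
  set V := (tangentP6 ζ).map (fderiv ℝ (J a b) ζ).toLinearMap with hV
  constructor
  · intro h
    have hlt : V < ⊤ := by
      rw [lt_top_iff_ne_top]; intro ht
      rw [ht, finrank_top, h3] at h; omega
    obtain ⟨φ, hφ, hle⟩ := Submodule.exists_le_ker_of_lt_top V hlt
    have hφv : ∀ p q s : ℝ, φ (p, q, s) =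
        p * φ (1, 0, 0) + q * φ (0, 1, 0) + s * φ (0, 0, 1) := by
      intro p q s
      have : (p, q, s) = p • ((1 : ℝ), (0 : ℝ), (0 : ℝ)) + q • ((0 : ℝ), (1 : ℝ), (0 : ℝ))
        + s • ((0 : ℝ), (0 : ℝ), (1 : ℝ)) := by simp
      rw [this]; simp only [map_add, map_smul, smul_eq_mul]
    refine ⟨φ (1, 0, 0) + φ (0, 0, 1) * (a ^ 2 + b ^ 2) / 2, φ (0, 1, 0), φ (0, 0, 1) / 2, ?_, ?_⟩
    · by_contra hc
      push Not at hc
      obtain ⟨e1, e2, e3⟩ := hc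
      have e3' : φ (0, 0, 1) = 0 := by linarith
      rw [e3'] at e1
      have e1' : φ (1, 0, 0) = 0 := by linarith
      refine hφ (LinearMap.ext fun v => ?_)
      rw [show v = (v.1, v.2.1, v.2.2) from rfl, hφv, e1', e2, e3']
      simp
    · intro δ hδ
      have := hle (Submodule.mem_map_of_mem hδ)
      rw [LinearMap.mem_ker, ContinuousLinearMap.coe_coe, fderiv_J, hφv] at this
      linarith
  · rintro ⟨c₁, c₂, c₃, hc, hδ⟩
    by_contra hcon
    have htop : V = ⊤ := by
      apply Submodule.eq_top_of_finrank_eq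
      have := V.finrank_le
      omega
    have hall : ∀ p q s : ℝ, c₁ * p + c₂ * q + c₃ * (2 * s - (a ^ 2 + b ^ 2) * p) = 0 := by
      intro p q s
      have : (p, q, s) ∈ V := by rw [htop]; trivial
      obtain ⟨δ, hm, he⟩ := this
      rw [ContinuousLinearMap.coe_coe, fderiv_J] at he
      simp only [Prod.mk.injEq] at he
      rw [← he.1, ← he.2.1, ← he.2.2]
      exact hδ δ hm
    have e2 := hall 0 1 0
    have e3 := hall 0 0 1
    have e1 := hall 1 0 0
    have : c₃ = 0 := by linarith
    subst this
    rcases hc with h | h | h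
    · apply h; linarith
    · apply h; linarith
    · exact h rfl

/-! ### The combination `2G - p²H` off the locus `x = 0` -/

/-- The identity `|x|² (2G - p²H) = -F²/2 + r² Re (x̄² (w² + x))` on `P⁶`, with
`F = |x|² t - 2 Re (x̄ z w)`. -/
lemma normSq_cx_mul {a b : ℝ} {ζ : Ambient} (hζ : ζ ∈ P6 a b) :
    cx ζ * conj (cx ζ) * (2 * (G a b ζ : ℂ) - ((a : ℂ) ^ 2 + b ^ 2) * H ζ) =
      - (cx ζ * conj (cx ζ) * ζ.1 2
        - (conj (cx ζ) * cz ζ * cw ζ + cx ζ * conj (cz ζ) * conj (cw ζ))) ^ 2 / 2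
      + ((a : ℂ) ^ 2 - b ^ 2) / 2 * (conj (cx ζ) ^ 2 * (cw ζ ^ 2 + cx ζ)
        + cx ζ ^ 2 * conj (cw ζ ^ 2 + cx ζ)) := by
  obtain ⟨h1, h2⟩ := mem_P6_iff.1 hζ
  have h1' := congrArg conj h1
  simp only [map_add, map_mul, map_pow, map_sub, Complex.conj_ofReal, Complex.conj_conj] at h1'
  rw [G_eq, H_eq]
  simp only [map_add, map_pow]
  linear_combination (cx ζ * conj (cx ζ) * ((ζ.1 2 : ℂ) ^ 2 / 4 + cw ζ * conj (cw ζ) / 2)) * h2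
    + (conj (cx ζ) ^ 2 * cw ζ ^ 2 / 2) * h1 + (cx ζ ^ 2 * conj (cw ζ) ^ 2 / 2) * h1'

/-- The identity of `normSq_cx_mul`, differentiated along a tangent vector of `P⁶`. -/
lemma normSq_cx_mul_fderiv {a b : ℝ} {ζ : Ambient} (hζ : ζ ∈ P6 a b) {δ : Ambient}
    (hδ : δ ∈ tangentP6 ζ) :
    cx ζ * conj (cx ζ) * (2 * (fderiv ℝ (G a b) ζ δ : ℂ)
        - ((a : ℂ) ^ 2 + b ^ 2) * fderiv ℝ H ζ δ)
      + (cx δ * conj (cx ζ) + cx ζ * conj (cx δ))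
        * (2 * (G a b ζ : ℂ) - ((a : ℂ) ^ 2 + b ^ 2) * H ζ) =
      - (cx ζ * conj (cx ζ) * ζ.1 2
        - (conj (cx ζ) * cz ζ * cw ζ + cx ζ * conj (cz ζ) * conj (cw ζ)))
        * ((cx δ * conj (cx ζ) + cx ζ * conj (cx δ)) * ζ.1 2 + cx ζ * conj (cx ζ) * δ.1 2
        - (conj (cx δ) * cz ζ * cw ζ + cx δ * conj (cz ζ) * conj (cw ζ)
          + conj (cx ζ) * cz δ * cw ζ + cx ζ * conj (cz δ) * conj (cw ζ)
          + conj (cx ζ) * cz ζ * cw δ + cx ζ * conj (cz ζ) * conj (cw δ)))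
      + ((a : ℂ) ^ 2 - b ^ 2) / 2 *
        (2 * conj (cx ζ) * conj (cx δ) * (cw ζ ^ 2 + cx ζ)
          + conj (cx ζ) ^ 2 * (2 * cw ζ * cw δ + cx δ)
          + 2 * cx ζ * cx δ * conj (cw ζ ^ 2 + cx ζ)
          + cx ζ ^ 2 * (2 * conj (cw ζ) * conj (cw δ) + conj (cx δ))) := by
  obtain ⟨h1, h2⟩ := mem_P6_iff.1 hζ
  obtain ⟨d1, d2⟩ := (mem_tangentP6_iff ζ δ).1 hδ
  have h1' := congrArg conj h1
  have d1' := congrArg conj d1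
  simp only [map_add, map_mul, map_pow, map_sub, map_zero, Complex.conj_ofReal, Complex.conj_conj,
    map_ofNat] at h1' d1'
  rw [G_eq, H_eq, fderiv_G, fderiv_H]
  simp only [map_add, map_pow]
  linear_combination (cx ζ * conj (cx ζ) * ((ζ.1 2 : ℂ) ^ 2 / 4 + cw ζ * conj (cw ζ) / 2)) * d2
    + ((cx δ * conj (cx ζ) + cx ζ * conj (cx δ))
        * ((ζ.1 2 : ℂ) ^ 2 / 4 + cw ζ * conj (cw ζ) / 2)
      + cx ζ * conj (cx ζ) * (ζ.1 2 * δ.1 2 / 2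
        + (cw δ * conj (cw ζ) + cw ζ * conj (cw δ)) / 2)) * h2
    + (conj (cx ζ) ^ 2 * cw ζ ^ 2 / 2) * d1 + (cx ζ ^ 2 * conj (cw ζ) ^ 2 / 2) * d1'
    + (conj (cx ζ) * conj (cx δ) * cw ζ ^ 2 + conj (cx ζ) ^ 2 * cw ζ * cw δ) * h1
    + (cx ζ * cx δ * conj (cw ζ) ^ 2 + cx ζ ^ 2 * conj (cw ζ) * conj (cw δ)) * h1'

/-! ### Lagrange equations in a rotated frame -/

section gauge

variable {a b : ℝ} {ζ : Ambient} {ρ : ℝ} {ϑ v : ℂ}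

/-- The identity `normSq_cx_mul` divided by `|x|²`, in the frame rotated by the phase `ϑ` of `x`:
`x = ρ ϑ` and `w = ϑ v`. -/
lemma two_G_sub_eq (hζ : ζ ∈ P6 a b) (hρ : ρ ≠ 0) (hϑ : ϑ * conj ϑ = 1)
    (hx : cx ζ = ρ * ϑ) (hw : cw ζ = ϑ * v) :
    2 * (G a b ζ : ℂ) - ((a : ℂ) ^ 2 + b ^ 2) * H ζ =
      - (ρ * ζ.1 2 - (cz ζ * v + conj (cz ζ) * conj v)) ^ 2 / 2
      + ((a : ℂ) ^ 2 - b ^ 2) / 2 * ((v ^ 2 + ρ * conj ϑ) + conj (v ^ 2 + ρ * conj ϑ)) := by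
  have hρ' : (ρ : ℂ) ≠ 0 := by exact_mod_cast hρ
  have hϑ0 : ϑ ≠ 0 := left_ne_zero_of_mul_eq_one hϑ
  have hc : conj ϑ = ϑ⁻¹ := eq_inv_of_mul_eq_one_right hϑ
  have h := normSq_cx_mul hζ
  refine mul_left_cancel₀ (pow_ne_zero 2 hρ') ?_
  simp only [hx, hw, map_add, map_mul, map_pow, Complex.conj_ofReal, hc, map_inv₀,
    inv_inv] at h ⊢
  field_simp at h ⊢
  linear_combination h

lemma fderiv_two_G_sub_vertical (hζ : ζ ∈ P6 a b) (hρ : ρ ≠ 0) (hϑ : ϑ * conj ϑ = 1)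
    (hx : cx ζ = ρ * ϑ) (hw : cw ζ = ϑ * v) (d : ℂ) (s : ℝ) :
    2 * (fderiv ℝ (G a b) ζ (ofComplex (ϑ * d) s 0 0 0) : ℂ)
        - ((a : ℂ) ^ 2 + b ^ 2) * fderiv ℝ H ζ (ofComplex (ϑ * d) s 0 0 0) =
      - (ρ * ζ.1 2 - (cz ζ * v + conj (cz ζ) * conj v))
        * (ρ * s - (cz ζ * d + conj (cz ζ) * conj d))
      + ((a : ℂ) ^ 2 - b ^ 2) * (v * d + conj v * conj d) := by
  have hρ' : (ρ : ℂ) ≠ 0 := by exact_mod_cast hρ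
  have hϑ0 : ϑ ≠ 0 := left_ne_zero_of_mul_eq_one hϑ
  have hc : conj ϑ = ϑ⁻¹ := eq_inv_of_mul_eq_one_right hϑ
  have hδ : ofComplex (ϑ * d) s 0 0 0 ∈ tangentP6 ζ := by
    rw [mem_tangentP6_iff]; simp
  have h := normSq_cx_mul_fderiv hζ hδ
  refine mul_left_cancel₀ (pow_ne_zero 2 hρ') ?_
  simp only [hx, hw, map_add, map_mul, map_pow, Complex.conj_ofReal, hc,
    cw_ofComplex, cx_ofComplex, cz_ofComplex, ofComplex_two, map_zero] at h ⊢
  field_simp at h ⊢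
  refine mul_left_cancel₀ (show 2 * ρ * ϑ ^ 2 ≠ 0 by simp [hρ', hϑ0]) ?_
  linear_combination h

/-- Infinitesimal rotations of the pair `(α, β)` about the first two axes, with an arbitrary change
of `ω`. -/
lemma rotation_mem_tangentP6 (ζ : Ambient) (w e : ℂ) (s : ℝ) :
    ofComplex w s (e * cz ζ) (e * conj (cz ζ))
      (-(conj e * cx ζ + e * conj (cy ζ)) / 2) ∈ tangentP6 ζ := by
  rw [mem_tangentP6_iff]
  simp only [cx_ofComplex, cy_ofComplex, cz_ofComplex, map_add, map_mul, map_neg, map_div₀,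
    Complex.conj_conj, map_ofNat]
  constructor <;> ring

/-- The differential of `2G - p²H` along an infinitesimal rotation. The `ω`-component of `δ` is
chosen so that `v = w / ϑ` does not change to first order. -/
lemma fderiv_two_G_sub_rotation (hζ : ζ ∈ P6 a b) (hρ : ρ ≠ 0) (hϑ : ϑ * conj ϑ = 1)
    (hx : cx ζ = ρ * ϑ) (hw : cw ζ = ϑ * v) (e : ℂ) {δ : Ambient}
    (hδ : δ = ofComplex (ϑ * (v * (e * cz ζ - conj e * conj (cz ζ)) / (2 * ρ))) 0
      (ϑ * e * cz ζ) (ϑ * e * conj (cz ζ))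
      (-(conj (ϑ * e) * cx ζ + ϑ * e * conj (cy ζ)) / 2)) :
    2 * (fderiv ℝ (G a b) ζ δ : ℂ) - ((a : ℂ) ^ 2 + b ^ 2) * fderiv ℝ H ζ δ =
      - (ρ * ζ.1 2 - (cz ζ * v + conj (cz ζ) * conj v))
        * (ζ.1 2 * (e * cz ζ + conj e * conj (cz ζ)) / 2
          + v * (conj e * ρ + ϑ * e * conj (cy ζ)) / 2
          + conj v * (e * ρ + conj ϑ * conj e * cy ζ) / 2)
      + ((a : ℂ) ^ 2 - b ^ 2) / 2 * (ϑ * e * cz ζ + conj ϑ * conj e * conj (cz ζ)) := by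
  have hρ' : (ρ : ℂ) ≠ 0 := by exact_mod_cast hρ
  have hϑ0 : ϑ ≠ 0 := left_ne_zero_of_mul_eq_one hϑ
  have hc : conj ϑ = ϑ⁻¹ := eq_inv_of_mul_eq_one_right hϑ
  have hδt : δ ∈ tangentP6 ζ := by
    rw [hδ]; exact rotation_mem_tangentP6 ζ _ _ _
  have h := normSq_cx_mul_fderiv hζ hδt
  rw [two_G_sub_eq hζ hρ hϑ hx hw] at h
  have e1 : cw δ = ϑ * (v * (e * cz ζ - conj e * conj (cz ζ)) / (2 * ρ)) := by simp [hδ]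
  have e2 : cx δ = ϑ * e * cz ζ := by simp [hδ]
  have e4 : cz δ = -(conj (ϑ * e) * cx ζ + ϑ * e * conj (cy ζ)) / 2 := by simp [hδ]
  have e5 : δ.1 2 = 0 := by simp [hδ]
  refine mul_left_cancel₀ (pow_ne_zero 2 hρ') ?_
  simp only [e1, e2, e4, e5, hx, hw, map_add, map_mul, map_pow, map_neg, map_div₀, map_sub,
    Complex.conj_ofReal, hc, map_inv₀, Complex.conj_conj, map_ofNat,
    inv_inv, Complex.ofReal_zero] at h ⊢
  field_simp at h ⊢
  refine mul_left_cancel₀ hρ' ?_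
  linear_combination h

lemma fderiv_H_rotation (hw : cw ζ = ϑ * v) (hϑ : ϑ * conj ϑ = 1) (e : ℂ) {δ : Ambient}
    (hδ : δ = ofComplex (ϑ * (v * (e * cz ζ - conj e * conj (cz ζ)) / (2 * ρ))) 0
      (ϑ * e * cz ζ) (ϑ * e * conj (cz ζ))
      (-(conj (ϑ * e) * cx ζ + ϑ * e * conj (cy ζ)) / 2)) :
    (fderiv ℝ H ζ δ : ℂ) = -(ϑ * e * conj (cz ζ) + conj ϑ * conj e * cz ζ) / 2 := by
  have hϑ0 : ϑ ≠ 0 := left_ne_zero_of_mul_eq_one hϑ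
  have hc : conj ϑ = ϑ⁻¹ := eq_inv_of_mul_eq_one_right hϑ
  rw [fderiv_H, hδ]
  simp only [hw, map_mul, map_div₀, map_sub, cw_ofComplex, cy_ofComplex,
    Complex.conj_ofReal, hc, Complex.conj_conj, map_ofNat, ofComplex_two,
    Complex.ofReal_zero]
  field_simp
  ring

lemma fderiv_K_rotation (hρ : ρ ≠ 0) (hx : cx ζ = ρ * ϑ) (hw : cw ζ = ϑ * v)
    (hϑ : ϑ * conj ϑ = 1) (e : ℂ) {δ : Ambient}
    (hδ : δ = ofComplex (ϑ * (v * (e * cz ζ - conj e * conj (cz ζ)) / (2 * ρ))) 0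
      (ϑ * e * cz ζ) (ϑ * e * conj (cz ζ))
      (-(conj (ϑ * e) * cx ζ + ϑ * e * conj (cy ζ)) / 2)) :
    (fderiv ℝ K ζ δ : ℂ) = (v ^ 2 + ρ * conj ϑ) * (ϑ * e * cz ζ)
      + conj (v ^ 2 + ρ * conj ϑ) * (conj ϑ * conj e * conj (cz ζ)) := by
  have hρ' : (ρ : ℂ) ≠ 0 := by exact_mod_cast hρ
  have hϑ0 : ϑ ≠ 0 := left_ne_zero_of_mul_eq_one hϑ
  have hc : conj ϑ = ϑ⁻¹ := eq_inv_of_mul_eq_one_right hϑ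
  rw [fderiv_K, hδ]
  simp only [hw, hx, map_add, map_mul, map_div₀, map_sub, map_pow, cw_ofComplex,
    cx_ofComplex, Complex.conj_ofReal, hc, map_inv₀, Complex.conj_conj, map_ofNat, inv_inv]
  field_simp
  ring

lemma eq_zero_of_forall_re {A : ℂ} (h : ∀ e : ℂ, e * A + conj e * conj A = 0) : A = 0 := by
  have h1 := congrArg Complex.re (h 1)
  have h2 := congrArg Complex.re (h Complex.I)
  simp at h1 h2
  apply Complex.ext <;> simp <;> linarith

/-- The Lagrange equations at a point of `P⁶` with `x = ρ ϑ ≠ 0`, `w = ϑ v`, from variations of `t`,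
of `w`, and from rotations of `(α, β)`. Here `f = ρ t - 2 Re (z v)`. -/
lemma lagrange_equations (hζ : ζ ∈ P6 a b) (hρ : ρ ≠ 0) (hϑ : ϑ * conj ϑ = 1)
    (hx : cx ζ = ρ * ϑ) (hw : cw ζ = ϑ * v) {c₁ c₂ c₃ f : ℝ}
    (hf : (f : ℂ) = ρ * ζ.1 2 - (cz ζ * v + conj (cz ζ) * conj v))
    (hc : ∀ δ ∈ tangentP6 ζ, c₁ * fderiv ℝ H ζ δ + c₂ * fderiv ℝ K ζ δ
        + c₃ * (2 * fderiv ℝ (G a b) ζ δ - (a ^ 2 + b ^ 2) * fderiv ℝ H ζ δ) = 0) :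
    c₁ * ζ.1 2 = c₃ * f * ρ ∧
    c₁ * conj v + 2 * c₂ * conj (v ^ 2 + ρ * conj ϑ) * v
      + c₃ * (f * cz ζ + ((a : ℂ) ^ 2 - b ^ 2) * v) = 0 ∧
    -c₁ * conj (cz ζ) + 2 * c₂ * (v ^ 2 + ρ * conj ϑ) * cz ζ
      + c₃ * (-f * (ζ.1 2 * conj ϑ * cz ζ + conj v * ρ * conj ϑ + v * conj (cy ζ))
        + ((a : ℂ) ^ 2 - b ^ 2) * cz ζ) = 0 := by
  have hρ' : (ρ : ℂ) ≠ 0 := by exact_mod_cast hρ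
  have hϑ0 : ϑ ≠ 0 := left_ne_zero_of_mul_eq_one hϑ
  have hcj : conj ϑ = ϑ⁻¹ := eq_inv_of_mul_eq_one_right hϑ
  have hC : ∀ δ ∈ tangentP6 ζ, (c₁ : ℂ) * fderiv ℝ H ζ δ + c₂ * fderiv ℝ K ζ δ
        + c₃ * (2 * fderiv ℝ (G a b) ζ δ - ((a : ℂ) ^ 2 + b ^ 2) * fderiv ℝ H ζ δ) = 0 :=
    fun δ hδ => by exact_mod_cast hc δ hδ
  have hvert : ∀ (d : ℂ) (s : ℝ), ofComplex (ϑ * d) s 0 0 0 ∈ tangentP6 ζ := fun d s => by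
    rw [mem_tangentP6_iff]; simp
  refine ⟨?_, ?_, ?_⟩
  · have h := hC _ (hvert 0 1)
    rw [fderiv_two_G_sub_vertical hζ hρ hϑ hx hw, ← hf, fderiv_H, fderiv_K] at h
    simp at h
    have h2 : (c₁ * ζ.1 2 : ℂ) = c₃ * f * ρ := by linear_combination h
    exact_mod_cast h2
  · apply eq_zero_of_forall_re
    intro d
    have h := hC _ (hvert d 0)
    rw [fderiv_two_G_sub_vertical hζ hρ hϑ hx hw, ← hf, fderiv_H, fderiv_K] at h
    simp only [hw, hx, map_add, map_mul, map_pow, map_sub, map_zero, cw_ofComplex, cx_ofComplex,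
      cy_ofComplex, ofComplex_two, Complex.conj_ofReal, hcj, map_inv₀, map_ofNat, inv_inv,
      Complex.conj_conj, Complex.ofReal_zero] at h ⊢
    field_simp at h ⊢
    refine mul_left_cancel₀ (show 2 * ϑ ≠ 0 by simp [hϑ0]) ?_
    linear_combination h
  · suffices h0 : ϑ * (-c₁ * conj (cz ζ) + 2 * c₂ * (v ^ 2 + ρ * conj ϑ) * cz ζ
      + c₃ * (-f * (ζ.1 2 * conj ϑ * cz ζ + conj v * ρ * conj ϑ + v * conj (cy ζ))
        + ((a : ℂ) ^ 2 - b ^ 2) * cz ζ)) = 0 from (mul_eq_zero.1 h0).resolve_left hϑ0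
    apply eq_zero_of_forall_re
    intro e
    have h := hC _ (rotation_mem_tangentP6 ζ
      (ϑ * (v * (e * cz ζ - conj e * conj (cz ζ)) / (2 * ρ))) (ϑ * e) 0)
    rw [fderiv_two_G_sub_rotation hζ hρ hϑ hx hw e rfl, ← hf,
      fderiv_H_rotation hw hϑ e rfl, fderiv_K_rotation hρ hx hw hϑ e rfl] at h
    simp only [map_add, map_mul, map_pow, map_sub, map_neg, Complex.conj_ofReal, hcj, map_inv₀,
      map_ofNat, inv_inv, Complex.conj_conj] at h ⊢
    field_simp at h ⊢
    linear_combination h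

end gauge

/-! ### Points with `2G - p²H = -r²√K` and `x ≠ 0` -/

/-- If `(h + κ)² = 4a²` or `(h - κ)² = 4b²`, the quadratic form of `κ` and `r²` is
a perfect square. -/
lemma quadratic_nonneg_of_level {a b h κ R : ℝ} (hR : R ^ 2 = a ^ 2 - b ^ 2)
    (h1 : (h + κ) ^ 2 = 4 * a ^ 2 ∨ (h - κ) ^ 2 = 4 * b ^ 2) :
    0 ≤ 2 * (a ^ 2 + b ^ 2) * κ ^ 2 - 2 * R ^ 2 * h * κ + R ^ 4 := by
  rcases h1 with h1 | h1
  · have : (h + κ - 2 * a) * (h + κ + 2 * a) = 0 := by linear_combination h1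
    rcases mul_eq_zero.1 this with h2 | h2
    · have e : 2 * (a ^ 2 + b ^ 2) * κ ^ 2 - 2 * R ^ 2 * h * κ + R ^ 4
        = (2 * a * κ - R ^ 2) ^ 2 := by
        linear_combination (-2 * R ^ 2 * κ) * h2 + (-2 * κ ^ 2) * (-hR)
      rw [e]; positivity
    · have e : 2 * (a ^ 2 + b ^ 2) * κ ^ 2 - 2 * R ^ 2 * h * κ + R ^ 4
        = (2 * a * κ + R ^ 2) ^ 2 := by
        linear_combination (-2 * R ^ 2 * κ) * h2 + (-2 * κ ^ 2) * (-hR)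
      rw [e]; positivity
  · have : (h - κ - 2 * b) * (h - κ + 2 * b) = 0 := by linear_combination h1
    rcases mul_eq_zero.1 this with h2 | h2
    · have e : 2 * (a ^ 2 + b ^ 2) * κ ^ 2 - 2 * R ^ 2 * h * κ + R ^ 4
        = (2 * b * κ - R ^ 2) ^ 2 := by
        linear_combination (-2 * R ^ 2 * κ) * h2 + (-2 * κ ^ 2) * (hR)
      rw [e]; positivity
    · have e : 2 * (a ^ 2 + b ^ 2) * κ ^ 2 - 2 * R ^ 2 * h * κ + R ^ 4
        = (2 * b * κ + R ^ 2) ^ 2 := by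
        linear_combination (-2 * R ^ 2 * κ) * h2 + (-2 * κ ^ 2) * (hR)
      rw [e]; positivity

section separation

variable {a b R ρ t h : ℝ} {u v x y z : ℂ}

/-- The data attached to a point of `P⁶` with `2G - p²H = -r²√K` and `x ≠ 0`: `R` stands for `r`,
`ρ` for `|x|`, `t` for `ω₃`, `h` for the value of `H`, `v` for `w` in the frame rotated by the phase
of `x`, and `u` is a square root of `v² + x̄`, so that `|u|² = √K`. The fields are the equations of
`P⁶`, the equation `2G - p²H = -r²√K` with its square root extracted (`ht`), and the energy. -/
structure Sep (a b R ρ t h : ℝ) (u v x y z : ℂ) : Prop where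
  hR : R ^ 2 = a ^ 2 - b ^ 2
  hρ : 0 < ρ
  hx : conj x = u ^ 2 - v ^ 2
  hxρ : x * conj x = ρ ^ 2
  h1 : x * conj y + z ^ 2 = R ^ 2
  h2 : x * conj x + y * conj y + 2 * (z * conj z) = 2 * ((a : ℂ) ^ 2 + b ^ 2)
  ht : (ρ * t : ℂ) = R * (u + conj u) + z * v + conj z * conj v
  hh : (h : ℂ) = v * conj v + (t : ℂ) ^ 2 / 2 - (y + conj y) / 2

namespace Sep

variable (S : Sep a b R ρ t h u v x y z)
include S

lemma x_eq : x = conj u ^ 2 - conj v ^ 2 := by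
  have := congrArg conj S.hx
  simpa using this

lemma hRc : (R : ℂ) ^ 2 = (a : ℂ) ^ 2 - b ^ 2 := by exact_mod_cast S.hR

lemma h1' : conj x * y + conj z ^ 2 = R ^ 2 := by
  have := congrArg conj S.h1
  simpa using this

lemma rho_ne : (ρ : ℂ) ≠ 0 := by exact_mod_cast S.hρ.ne'

lemma constraint : (ρ : ℂ) ^ 4 + (R ^ 2 - z ^ 2) * (R ^ 2 - conj z ^ 2)
    + 2 * (z * conj z) * ρ ^ 2 = 2 * ((a : ℂ) ^ 2 + b ^ 2) * ρ ^ 2 := by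
  linear_combination (ρ : ℂ) ^ 2 * S.h2 - (ρ : ℂ) ^ 2 * S.hxρ + (y * conj y) * S.hxρ
    - conj x * y * S.h1 - (R ^ 2 - z ^ 2) * S.h1'

lemma product_eq : (u ^ 2 - v ^ 2) * (conj u ^ 2 - conj v ^ 2) = (ρ : ℂ) ^ 2 := by
  rw [← S.hx, ← S.x_eq, mul_comm, S.hxρ]

lemma energy : (h : ℂ) * ρ ^ 2 = v * conj v * ρ ^ 2
    + (z * v + R * u) * (conj z * conj v + R * conj u)
    + ((z * u + R * v) ^ 2 + (conj z * conj u + R * conj v) ^ 2) / 2 := by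
  linear_combination (ρ : ℂ) ^ 2 * S.hh
    + (ρ * t + (z * v + R * u) + (conj z * conj v + R * conj u)) / 2 * S.ht
    + (y + conj y) / 2 * S.hxρ - conj x / 2 * S.h1 - x / 2 * S.h1'
    - (R ^ 2 - z ^ 2) / 2 * S.hx - (R ^ 2 - conj z ^ 2) / 2 * S.x_eq

/-- The sum in the parentheses is twice the real part of its first term, and the last term is
`2 (Re (z u + R v))²`. -/
lemma energy_sub : ((h : ℂ) - u * conj u) * ρ ^ 2 =
    - ((u + v) * (conj u - conj v) * (ρ ^ 2 - (z + R) * (R - conj z))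
      + (conj u + conj v) * (u - v) * (ρ ^ 2 - (conj z + R) * (R - z))) / 2
    + ((z * u + R * v) + (conj z * conj u + R * conj v)) ^ 2 / 2 := by
  linear_combination S.energy

lemma energy_add : ((h : ℂ) + u * conj u) * ρ ^ 2 =
    ((u + v) * (conj u + conj v) * (ρ ^ 2 + (z + R) * (conj z + R))
      + (u - v) * (conj u - conj v) * (ρ ^ 2 + (z - R) * (conj z - R))) / 2
    + ((z * u + R * v) - (conj z * conj u + R * conj v)) ^ 2 / 2 := by
  linear_combination S.energy

/-- The modulus of `ρ² - (z + R)(R - z̄)` is `2 b ρ`. -/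
lemma norm_eq_two_b : (ρ ^ 2 - (z + R) * (R - conj z)) * (ρ ^ 2 - (conj z + R) * (R - z))
    = 4 * b ^ 2 * (ρ : ℂ) ^ 2 := by
  linear_combination S.constraint - 2 * ρ ^ 2 * S.hRc

lemma prod_eq_two_a : (ρ ^ 2 + (z + R) * (conj z + R)) * (ρ ^ 2 + (z - R) * (conj z - R))
    = 4 * a ^ 2 * (ρ : ℂ) ^ 2 := by
  linear_combination S.constraint + 2 * ρ ^ 2 * S.hRc

/-- The first term of `energy_sub` has real part at least `-2 b ρ²`, since its modulus is `2 b ρ²`,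
and the last term is nonnegative. -/
lemma kappa_le (hb : 0 < b) : ‖u‖ ^ 2 ≤ h + 2 * b := by
  set M := (u + v) * (conj u - conj v) * (ρ ^ 2 - (z + R) * (R - conj z)) with hM
  have hMM : M * conj M = ((2 * b * ρ ^ 2 : ℝ) : ℂ) ^ 2 := by
    simp only [hM, map_mul, map_add, map_sub, map_pow, Complex.conj_conj, Complex.conj_ofReal]
    push_cast
    linear_combination (ρ ^ 2 - (z + R) * (R - conj z)) * (ρ ^ 2 - (conj z + R) * (R - z))
      * S.product_eq + ρ ^ 2 * S.norm_eq_two_b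
  have hre : M.re ≤ 2 * b * ρ ^ 2 := by
    have h0 : (0 : ℝ) ≤ 2 * b * ρ ^ 2 := by positivity
    have hn : ‖M‖ ^ 2 = (2 * b * ρ ^ 2) ^ 2 := by
      rw [Complex.mul_conj'] at hMM
      exact_mod_cast hMM
    have : ‖M‖ = 2 * b * ρ ^ 2 := by
      rwa [sq_eq_sq₀ (norm_nonneg _) h0] at hn
    exact this ▸ Complex.re_le_norm M
  have he : ((h - ‖u‖ ^ 2) * ρ ^ 2 : ℝ) = -M.re + 2 * (z * u + R * v).re ^ 2 := by
    have e := S.energy_sub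
    rw [Complex.mul_conj'] at e
    have e1 : (u + v) * (conj u - conj v) * (ρ ^ 2 - (z + R) * (R - conj z))
      + (conj u + conj v) * (u - v) * (ρ ^ 2 - (conj z + R) * (R - z)) = ((2 * M.re : ℝ) : ℂ) := by
      rw [← Complex.add_conj, hM]
      simp
    have e2 : (z * u + R * v) + (conj z * conj u + R * conj v)
        = ((2 * (z * u + R * v).re : ℝ) : ℂ) := by
      rw [← Complex.add_conj]
      simp
    rw [e1, e2] at e
    have e3 : (h - ‖u‖ ^ 2) * ρ ^ 2
        = -(2 * M.re) / 2 + (2 * (z * u + R * v).re) ^ 2 / 2 := by exact_mod_cast e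
    rw [e3]; ring
  have hρ2 : 0 < ρ ^ 2 := by have := S.hρ; positivity
  nlinarith [sq_nonneg (z * u + R * v).re]

/-- For purely imaginary `u`, the quadratic multiplied by `ρ²` is the square of a real number. -/
lemma quadratic_nonneg_of_re_add (hre : u + conj u = 0) :
    0 ≤ 2 * (a ^ 2 + b ^ 2) * (‖u‖ ^ 2) ^ 2 - 2 * R ^ 2 * h * ‖u‖ ^ 2 + R ^ 4 := by
  have hρ2 : 0 < ρ ^ 2 := by have := S.hρ; positivity
  have key : (ρ : ℂ) ^ 2 * (2 * ((a : ℂ) ^ 2 + b ^ 2) * (u * conj u) ^ 2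
      - 2 * R ^ 2 * h * (u * conj u) + R ^ 4) =
      (R ^ 2 * (v * conj v) - u * conj u * (ρ ^ 2 + z * conj z)) ^ 2 := by
    have hu : conj u = -u := by linear_combination hre
    have hp := S.product_eq
    have he := S.energy
    rw [hu] at hp he ⊢
    linear_combination (2 * R ^ 2 * u ^ 2) * he - u ^ 4 * S.constraint - R ^ 4 * hp
  rw [Complex.mul_conj', Complex.mul_conj', Complex.mul_conj'] at key
  have key' : ρ ^ 2 * (2 * (a ^ 2 + b ^ 2) * (‖u‖ ^ 2) ^ 2
      - 2 * R ^ 2 * h * ‖u‖ ^ 2 + R ^ 4) =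
      (R ^ 2 * ‖v‖ ^ 2 - ‖u‖ ^ 2 * (ρ ^ 2 + ‖z‖ ^ 2)) ^ 2 := by exact_mod_cast key
  by_contra hneg
  push Not at hneg
  nlinarith [sq_nonneg (R ^ 2 * ‖v‖ ^ 2 - ‖u‖ ^ 2 * (ρ ^ 2 + ‖z‖ ^ 2))]

/-- If `q = z u + R v` is real, then `hE` says that the two factors in `energy_add` coincide; their
product being `4 a² ρ⁴`, this determines `(h + |u|²)²`. -/
lemma add_kappa_sq {m : ℝ} (hm : (m : ℂ) * ρ = t)
    (hq : z * u + R * v = conj z * conj u + R * conj v)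
    (hE : u * conj v + conj u * v + m * (z * u + R * v) = 0) :
    (h + ‖u‖ ^ 2) ^ 2 = 4 * a ^ 2 := by
  have e := S.energy_add
  have hpp := S.product_eq
  have hta := S.prod_eq_two_a
  set M := (u + v) * (conj u + conj v) * (ρ ^ 2 + (z + R) * (conj z + R)) with hM
  set N := (u - v) * (conj u - conj v) * (ρ ^ 2 + (z - R) * (conj z - R)) with hN
  have hMN : M * N = 4 * a ^ 2 * (ρ : ℂ) ^ 4 := by
    rw [hM, hN]
    linear_combination (ρ ^ 2 + (z + R) * (conj z + R)) * (ρ ^ 2 + (z - R) * (conj z - R)) * hpp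
      + ρ ^ 2 * hta
  have hMeq : M - N = 0 := by
    rw [hM, hN]
    linear_combination 2 * ρ ^ 2 * hE - 2 * (z * u + R * v) * ρ * hm
      - 2 * (z * u + R * v) * S.ht - (2 * (z * v + R * u)) * hq
  have e2 : ((h : ℂ) + u * conj u) * ρ ^ 2 = M := by
    linear_combination e - hMeq / 2 + (z * u + R * v - (conj z * conj u + R * conj v)) / 2 * hq
  have h4 : (ρ : ℂ) ^ 4 ≠ 0 := pow_ne_zero 4 S.rho_ne
  have e3 : ((h : ℂ) + u * conj u) ^ 2 = 4 * a ^ 2 := by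
    refine mul_right_cancel₀ h4 ?_
    linear_combination (((h : ℂ) + u * conj u) * ρ ^ 2 + M) * e2 + hMN + M * hMeq
  rw [Complex.mul_conj'] at e3
  exact_mod_cast e3

/-- The counterpart of `add_kappa_sq` for purely imaginary `q = z u + R v`: the two factors in
`energy_sub` coincide, with product `4 b² ρ⁴`. -/
lemma sub_kappa_sq {m : ℝ} (hm : (m : ℂ) * ρ = t)
    (hq : -(z * u + R * v) = conj z * conj u + R * conj v)
    (hE : u * conj v - conj u * v + m * (z * u + R * v) = 0) :
    (h - ‖u‖ ^ 2) ^ 2 = 4 * b ^ 2 := by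
  have e := S.energy_sub
  have hpp := S.product_eq
  have hta := S.norm_eq_two_b
  set M := (u + v) * (conj u - conj v) * (ρ ^ 2 - (z + R) * (R - conj z)) with hM
  set N := (conj u + conj v) * (u - v) * (ρ ^ 2 - (conj z + R) * (R - z)) with hN
  have hMN : M * N = 4 * b ^ 2 * (ρ : ℂ) ^ 4 := by
    rw [hM, hN]
    linear_combination (ρ ^ 2 - (z + R) * (R - conj z)) * (ρ ^ 2 - (conj z + R) * (R - z)) * hpp
      + ρ ^ 2 * hta
  have hMeq : M - N = 0 := by
    rw [hM, hN]
    linear_combination -2 * ρ ^ 2 * hE + 2 * (z * u + R * v) * ρ * hm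
      + 2 * (z * u + R * v) * S.ht - (2 * (z * v + R * u)) * hq
  have e2 : ((h : ℂ) - u * conj u) * ρ ^ 2 = -M := by
    linear_combination e + hMeq / 2 - (z * u + R * v + (conj z * conj u + R * conj v)) / 2 * hq
  have h4 : (ρ : ℂ) ^ 4 ≠ 0 := pow_ne_zero 4 S.rho_ne
  have e3 : ((h : ℂ) - u * conj u) ^ 2 = 4 * b ^ 2 := by
    refine mul_right_cancel₀ h4 ?_
    linear_combination (((h : ℂ) - u * conj u) * ρ ^ 2 - M) * e2 + hMN + M * hMeq
  rw [Complex.mul_conj'] at e3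
  exact_mod_cast e3

/-- The Lagrange equations `Et`, `Ew`, `Er` force the quadratic to be nonnegative: they give a real
`c` with `c q = q̄` for `q = z u + R v`, so that `add_kappa_sq` or `sub_kappa_sq` applies. -/
lemma quadratic_nonneg_of_lagrange {c₁ c₂ c₃ f : ℝ} {ϑ' : ℂ}
    (hc : c₁ ≠ 0 ∨ c₂ ≠ 0 ∨ c₃ ≠ 0) (hϑ : ρ * ϑ' = conj x)
    (hf : (f : ℂ) = R * (u + conj u)) (hf0 : f ≠ 0)
    (Et : c₁ * t = c₃ * f * ρ)
    (Ew : c₁ * conj v + 2 * c₂ * conj (u ^ 2) * v + c₃ * (f * z + (R : ℂ) ^ 2 * v) = 0)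
    (Er : -c₁ * conj z + 2 * c₂ * u ^ 2 * z
      + c₃ * (-f * (t * ϑ' * z + conj v * conj x + v * conj y) + (R : ℂ) ^ 2 * z) = 0) :
    0 ≤ 2 * (a ^ 2 + b ^ 2) * (‖u‖ ^ 2) ^ 2 - 2 * R ^ 2 * h * ‖u‖ ^ 2 + R ^ 4 := by
  have hfc : (f : ℂ) ≠ 0 := by exact_mod_cast hf0
  have hu : u ≠ 0 := by
    rintro rfl
    simp at hf
    exact hf0 hf
  have hu' : conj u ≠ 0 := by simpa using hu
  have hρ0 := S.hρ.ne'
  have hρc := S.rho_ne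
  -- `c₁ = 0` is possible only at `v = z = 0`, where the quadratic equals `ρ⁴`
  by_cases h1 : c₁ = 0
  · subst h1
    have h3 : c₃ = 0 := by
      have : c₃ * (f * ρ) = 0 := by linarith
      rcases mul_eq_zero.1 this with h | h
      · exact h
      · exact absurd h (mul_ne_zero hf0 hρ0)
    subst h3
    have h2 : (c₂ : ℂ) ≠ 0 := by
      rcases hc with h | h | h
      · exact absurd rfl h
      · exact_mod_cast h
      · exact absurd rfl h
    have hv : v = 0 := by
      simpa [h2, hu] using Ew
    have hz : z = 0 := by
      simpa [h2, hu] using Er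
    have hp := S.product_eq
    have he := S.energy
    have hC := S.constraint
    subst hv hz
    have hκ : ‖u‖ ^ 2 = ρ := by
      have : (u * conj u) ^ 2 = (ρ : ℂ) ^ 2 := by rw [← hp]; simp; ring
      rw [Complex.mul_conj'] at this
      have h' : (‖u‖ ^ 2) ^ 2 = ρ ^ 2 := by exact_mod_cast this
      rwa [sq_eq_sq₀ (by positivity) S.hρ.le] at h'
    have hhρ : h * ρ ^ 2 = R ^ 2 * ρ := by
      rw [← hκ]
      have e : (h : ℂ) * (ρ : ℂ) ^ 2 = R ^ 2 * (u * conj u) := by rw [he]; simp; ring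
      rw [Complex.mul_conj', ← Complex.ofReal_pow ‖u‖, hκ] at e
      rw [hκ]
      exact_mod_cast e
    have hC' : ρ ^ 4 + R ^ 4 = 2 * (a ^ 2 + b ^ 2) * ρ ^ 2 := by
      have e : (ρ : ℂ) ^ 4 + R ^ 4 = 2 * ((a : ℂ) ^ 2 + b ^ 2) * ρ ^ 2 := by
        rw [← hC]; simp; ring
      exact_mod_cast e
    have hh' : h * ρ = R ^ 2 := by
      refine mul_right_cancel₀ hρ0 ?_
      linear_combination hhρ
    have e : 2 * (a ^ 2 + b ^ 2) * (‖u‖ ^ 2) ^ 2 - 2 * R ^ 2 * h * ‖u‖ ^ 2 + R ^ 4 = ρ ^ 4 := by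
      rw [hκ]; linear_combination -hC' - 2 * R ^ 2 * hh'
    rw [e]; positivity
  · have h1c : (c₁ : ℂ) ≠ 0 := by exact_mod_cast h1
    obtain ⟨m, hm⟩ : ∃ m : ℝ, m * ρ = t := ⟨t / ρ, by field_simp⟩
    have hmc : (m : ℂ) * ρ = t := by exact_mod_cast hm
    have hm3 : (c₃ : ℂ) * f = c₁ * m := by
      refine mul_right_cancel₀ hρc ?_
      have : (c₁ : ℂ) * t = c₃ * f * ρ := by exact_mod_cast Et
      linear_combination -this - c₁ * hmc
    set c : ℝ := (2 * c₂ * ‖u‖ ^ 2 - c₃ * R ^ 2) / c₁ with hcdef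
    have hcc : (c₁ : ℂ) * c = 2 * c₂ * (u * conj u) - c₃ * R ^ 2 := by
      rw [Complex.mul_conj', hcdef]; push_cast; field_simp
    have E1 : u * conj v + c * (conj u * v) + m * (z * u + R * v) = 0 := by
      refine (mul_eq_zero.1 (?_ : (c₁ : ℂ) * _ = 0)).resolve_left h1c
      simp only [map_pow] at Ew
      linear_combination u * Ew + (conj u * v) * hcc - (z * u + R * v) * hm3
        + c₃ * R * v * hf
    have E2 : z * (c * u + R * m) = conj u * (conj z
        + m * (conj x * (m * z + conj v) + v * conj y)) := by
      refine mul_left_cancel₀ h1c ?_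
      linear_combination conj u * Er + (u * z) * hcc - z * R * hm3 + z * R * c₃ * hf
        - z * conj u * c₃ * f * ϑ' * hmc + z * conj u * c₃ * f * m * hϑ
        + (z * conj u * conj x * m + conj u * (conj x * conj v + v * conj y)) * hm3
    have E1' : conj u * v + c * (u * conj v) + m * (conj z * conj u + R * conj v) = 0 := by
      simpa using congrArg conj E1
    -- eliminate `y` and `t` from the two equations through the equations of `P⁶`
    have hq : c * (z * u + R * v) = conj z * conj u + R * conj v := by
      refine mul_left_cancel₀ (pow_ne_zero 2 hu') ?_
      linear_combination (conj u ^ 2 - conj v ^ 2) * E2 + conj u * R * E1 + conj v * z * E1'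
        + conj u * (conj v + m * z) * (S.ht + ρ * hmc)
        - conj u * m * (m * conj x * z + conj v * conj x + v * conj y) * S.x_eq
        + conj u * m * (m * z + conj v) * S.hxρ + conj u * m * v * S.h1
    have hq' : c * (conj z * conj u + R * conj v) = z * u + R * v := by
      simpa using congrArg conj hq
    apply quadratic_nonneg_of_level S.hR
    -- `c² = 1` unless `q = 0`; in that case `E1` gives `c² = 1` or `v = 0`
    by_cases hq0 : z * u + R * v = 0
    · have hq0' : conj z * conj u + R * conj v = 0 := by simpa using congrArg conj hq0
      rw [hq0, mul_zero, add_zero] at E1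
      rw [hq0', mul_zero, add_zero] at E1'
      have h0 : (1 - (c : ℂ)) * (1 + c) * (u * conj v) = 0 := by
        linear_combination E1 - c * E1'
      rcases mul_eq_zero.1 h0 with h0 | h0
      · rcases mul_eq_zero.1 h0 with h0 | h0
        · left
          refine S.add_kappa_sq hmc (by rw [hq0, hq0']) ?_
          linear_combination E1 + (conj u * v) * h0 + m * hq0
        · right
          refine S.sub_kappa_sq hmc (by rw [hq0, hq0', neg_zero]) ?_
          linear_combination E1 - (conj u * v) * h0 + m * hq0
      · have hv : v = 0 := by simpa [hu] using h0
        left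
        refine S.add_kappa_sq hmc (by rw [hq0, hq0']) ?_
        rw [hq0, hv]; simp
    · have h0 : (1 - (c : ℂ)) * (1 + c) * (z * u + R * v) = 0 := by
        linear_combination -c * hq - hq'
      rcases mul_eq_zero.1 ((mul_eq_zero.1 h0).resolve_right hq0) with h0 | h0
      · left
        refine S.add_kappa_sq hmc ?_ ?_
        · linear_combination hq + (z * u + R * v) * h0
        · linear_combination E1 + (conj u * v) * h0
      · right
        refine S.sub_kappa_sq hmc ?_ ?_
        · linear_combination hq - (z * u + R * v) * h0
        · linear_combination E1 - (conj u * v) * h0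

end Sep

end separation

/-! ### Necessary inequalities on critical values -/

lemma r_pos {a b : ℝ} (hb : 0 < b) (hab : b < a) : 0 < r a b :=
  Real.sqrt_pos.2 (by nlinarith)

lemma r_sq {a b : ℝ} (hb : 0 < b) (hab : b < a) : r a b ^ 2 = a ^ 2 - b ^ 2 :=
  Real.sq_sqrt (by nlinarith)

lemma p_sq (a b : ℝ) : p a b ^ 2 = a ^ 2 + b ^ 2 := Real.sq_sqrt (by positivity)

section bounds

variable {a b : ℝ} {ζ : Ambient}

lemma K_eq_norm_sq (ζ : Ambient) : K ζ = ‖cw ζ ^ 2 + cx ζ‖ ^ 2 := by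
  have h := K_eq ζ
  rw [Complex.mul_conj'] at h
  exact_mod_cast h

lemma H_eq_norm (ζ : Ambient) : H ζ = ‖cw ζ‖ ^ 2 + ζ.1 2 ^ 2 / 2 - (cy ζ).re := by
  have h := H_eq ζ
  rw [Complex.mul_conj', Complex.add_conj] at h
  have h' : H ζ = ‖cw ζ‖ ^ 2 + ζ.1 2 ^ 2 / 2 - (2 * (cy ζ).re) / 2 := by exact_mod_cast h
  rw [h']; ring

lemma norm_constraint (hζ : ζ ∈ P6 a b) :
    ‖cx ζ‖ ^ 2 + ‖cy ζ‖ ^ 2 + 2 * ‖cz ζ‖ ^ 2 = 2 * (a ^ 2 + b ^ 2) := by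
  have h := (mem_P6_iff.1 hζ).2
  simp only [Complex.mul_conj'] at h
  exact_mod_cast h

lemma norm_mul_norm (hζ : ζ ∈ P6 a b) :
    ‖cx ζ‖ * ‖cy ζ‖ = ‖((a ^ 2 - b ^ 2 : ℝ) : ℂ) - cz ζ ^ 2‖ := by
  have h := (mem_P6_iff.1 hζ).1
  rw [← Complex.norm_conj (cy ζ), ← norm_mul]
  congr 1
  push_cast
  linear_combination h

lemma norm_add_norm_le (hb : 0 < b) (hab : b < a) (hζ : ζ ∈ P6 a b) :
    ‖cx ζ‖ + ‖cy ζ‖ ≤ 2 * a := by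
  have h := norm_constraint hζ
  have h' := norm_mul_norm hζ
  have hr : 0 ≤ a ^ 2 - b ^ 2 := by nlinarith
  have h3 : ‖((a ^ 2 - b ^ 2 : ℝ) : ℂ) - cz ζ ^ 2‖ ≤ (a ^ 2 - b ^ 2) + ‖cz ζ‖ ^ 2 := by
    refine (norm_sub_le _ _).trans ?_
    rw [Complex.norm_real, norm_pow, Real.norm_of_nonneg hr]
  refine abs_le_of_sq_le_sq' ?_ (by linarith) |>.2
  nlinarith

lemma norm_cy_le (hb : 0 < b) (hab : b < a) (hζ : ζ ∈ P6 a b) :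
    ‖cy ζ‖ ≤ ‖cx ζ‖ + 2 * b := by
  have h := norm_constraint hζ
  have h' := norm_mul_norm hζ
  have hr : 0 ≤ a ^ 2 - b ^ 2 := by nlinarith
  have h3 : (a ^ 2 - b ^ 2) - ‖cz ζ‖ ^ 2 ≤ ‖((a ^ 2 - b ^ 2 : ℝ) : ℂ) - cz ζ ^ 2‖ := by
    refine le_trans ?_ (norm_sub_norm_le _ _)
    rw [Complex.norm_real, norm_pow, Real.norm_of_nonneg hr]
  have : ‖cy ζ‖ - ‖cx ζ‖ ≤ 2 * b := by
    refine abs_le_of_sq_le_sq' ?_ (by linarith) |>.2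
    nlinarith
  linarith

lemma neg_add_le_H (hb : 0 < b) (hab : b < a) (hζ : ζ ∈ P6 a b) : -(a + b) ≤ H ζ := by
  have h := norm_add_norm_le hb hab hζ
  have h' := norm_cy_le hb hab hζ
  rw [H_eq_norm]
  have := Complex.re_le_norm (cy ζ)
  have : 0 ≤ ‖cw ζ‖ ^ 2 + ζ.1 2 ^ 2 / 2 := by positivity
  linarith

lemma norm_le_H_add (hb : 0 < b) (hab : b < a) (hζ : ζ ∈ P6 a b) :
    ‖cw ζ ^ 2 + cx ζ‖ ≤ H ζ + 2 * a := by
  have h := norm_add_norm_le hb hab hζ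
  have h2 := norm_add_le (cw ζ ^ 2) (cx ζ)
  rw [norm_pow] at h2
  rw [H_eq_norm]
  have := Complex.re_le_norm (cy ζ)
  have : 0 ≤ ζ.1 2 ^ 2 / 2 := by positivity
  linarith

lemma neg_norm_le_H_add (hb : 0 < b) (hab : b < a) (hζ : ζ ∈ P6 a b) :
    -‖cw ζ ^ 2 + cx ζ‖ ≤ H ζ + 2 * b := by
  have h := norm_cy_le hb hab hζ
  have h2 : ‖cx ζ‖ ≤ ‖cw ζ ^ 2 + cx ζ‖ + ‖cw ζ‖ ^ 2 := by
    have h3 := norm_sub_le (cw ζ ^ 2 + cx ζ) (cw ζ ^ 2)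
    rwa [add_sub_cancel_left, norm_pow] at h3
  rw [H_eq_norm]
  have := Complex.re_le_norm (cy ζ)
  have : 0 ≤ ζ.1 2 ^ 2 / 2 := by positivity
  linarith

end bounds

section vanishing

variable {a b : ℝ} {ζ : Ambient}

lemma cz_of_cx_eq_zero (hb : 0 < b) (hab : b < a) (hζ : ζ ∈ P6 a b) (hx : cx ζ = 0) :
    conj (cz ζ) = cz ζ ∧ cz ζ ^ 2 = (a : ℂ) ^ 2 - b ^ 2 ∧
      cy ζ * conj (cy ζ) = 4 * (b : ℂ) ^ 2 := by
  obtain ⟨h1, h2⟩ := mem_P6_iff.1 hζ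
  rw [hx] at h1 h2
  simp only [zero_mul, zero_add] at h1 h2
  have hz : conj (cz ζ) = cz ζ := by
    have hre := congrArg Complex.re h1
    have him := congrArg Complex.im h1
    simp [pow_two] at hre him
    rw [Complex.conj_eq_iff_im]
    rcases (by
      have : (cz ζ).re * (cz ζ).im = 0 := by linarith
      exact mul_eq_zero.1 this) with h | h
    · exfalso
      rw [h] at hre
      nlinarith [sq_nonneg (cz ζ).im]
    · exact h
  refine ⟨hz, h1, ?_⟩
  rw [hz] at h2
  linear_combination h2 - 2 * h1

lemma kappa_le_of_cx_eq_zero (hb : 0 < b) (hab : b < a) (hζ : ζ ∈ P6 a b) (hx : cx ζ = 0) :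
    ‖cw ζ ^ 2 + cx ζ‖ ≤ H ζ + 2 * b := by
  have h := norm_cy_le hb hab hζ
  rw [hx] at h ⊢
  rw [add_zero, norm_pow, H_eq_norm]
  rw [norm_zero] at h
  have := Complex.re_le_norm (cy ζ)
  have : 0 ≤ ζ.1 2 ^ 2 / 2 := by positivity
  linarith

/-- On `x = 0` one has `z = ±r`, `|y| = 2b`. If `t` and `w` do not vanish, the variations of `t` and
`w` determine the multipliers up to a factor, and an infinitesimal rotation expresses `t` through
`w`; the claim is then the Cauchy-Schwarz inequality. -/
lemma quadratic_nonneg_of_cx_eq_zero (hb : 0 < b) (hab : b < a) (hζ : ζ ∈ P6 a b)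
    (hx : cx ζ = 0) (hr : rankJ a b ζ < 3) :
    0 ≤ 2 * (a ^ 2 + b ^ 2) * ‖cw ζ ^ 2 + cx ζ‖ ^ 2
      - 2 * r a b ^ 2 * H ζ * ‖cw ζ ^ 2 + cx ζ‖ + r a b ^ 4 := by
  obtain ⟨hzc, hz2, hy2⟩ := cz_of_cx_eq_zero hb hab hζ hx
  obtain ⟨c₁, c₂, c₃, hc, hδ⟩ := rankJ_lt_three_iff.1 hr
  have hR := r_sq hb hab
  have hRpos := r_pos hb hab
  have hRc : (r a b : ℂ) ^ 2 = (a : ℂ) ^ 2 - b ^ 2 := by exact_mod_cast hR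
  set R := r a b
  have hC : ∀ δ ∈ tangentP6 ζ, (c₁ : ℂ) * fderiv ℝ H ζ δ + c₂ * fderiv ℝ K ζ δ
        + c₃ * (2 * fderiv ℝ (G a b) ζ δ - ((a : ℂ) ^ 2 + b ^ 2) * fderiv ℝ H ζ δ) = 0 :=
    fun δ hδ' => by exact_mod_cast hδ δ hδ'
  rw [hx, add_zero, norm_pow, H_eq_norm]
  set n := ‖cw ζ‖ ^ 2 with hn
  have hwn : cw ζ * conj (cw ζ) = (n : ℂ) := by rw [Complex.mul_conj', hn]; push_cast; rfl
  have hyn : (cy ζ).re ^ 2 + (cy ζ).im ^ 2 = 4 * b ^ 2 := by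
    have h1 : Complex.normSq (cy ζ) = 4 * b ^ 2 := by
      rw [Complex.mul_conj] at hy2; exact_mod_cast hy2
    rw [Complex.normSq_apply] at h1; linarith
  have hid : 2 * (a ^ 2 + b ^ 2) * n ^ 2 - 2 * R ^ 2 * (n + ζ.1 2 ^ 2 / 2 - (cy ζ).re) * n + R ^ 4
      = (R ^ 2 + n * (cy ζ).re) ^ 2 + (n * (cy ζ).im) ^ 2 - R ^ 2 * n * ζ.1 2 ^ 2 := by
    linear_combination -n ^ 2 * hyn - 2 * n ^ 2 * hR
  rw [hid]
  rcases eq_or_ne n 0 with hn0 | hn0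
  · rw [hn0]; simp; positivity
  have hnpos : 0 < n := lt_of_le_of_ne (by positivity) (Ne.symm hn0)
  rcases eq_or_ne (ζ.1 2) 0 with ht0 | ht0
  · rw [ht0]; simp; positivity
  have hvert : ∀ (d : ℂ) (s : ℝ), ofComplex d s 0 0 0 ∈ tangentP6 ζ := fun d s => by
    rw [mem_tangentP6_iff]; simp
  have hc1 : c₁ = 0 := by
    have h := hC _ (hvert 0 1)
    rw [fderiv_G, fderiv_H, fderiv_K] at h
    simp only [hx, hzc, cw_ofComplex, cx_ofComplex, cy_ofComplex, cz_ofComplex, ofComplex_two,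
      map_zero, mul_zero, add_zero, Complex.ofReal_one] at h
    have h2 : (c₁ : ℂ) * ζ.1 2 = 0 := by
      linear_combination h - c₃ * ζ.1 2 / 2 * hy2 - c₃ * ζ.1 2 * hz2
    exact_mod_cast (mul_eq_zero.1 h2).resolve_right (by exact_mod_cast ht0)
  subst hc1
  have h23 : (c₃ : ℂ) * R ^ 2 = 2 * c₂ * n := by
    have h := hC _ (hvert (cw ζ) 0)
    rw [fderiv_G, fderiv_H, fderiv_K] at h
    simp only [hx, hzc, cw_ofComplex, cx_ofComplex, cy_ofComplex, cz_ofComplex, ofComplex_two,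
      map_zero, map_mul, map_add, map_pow, map_ofNat, Complex.ofReal_zero] at h
    refine mul_left_cancel₀ (show (n : ℂ) ≠ 0 by exact_mod_cast hn0) ?_
    linear_combination -h / 2 + (2 * c₂ * (cw ζ * conj (cw ζ) + n)
      + c₃ * (cy ζ * conj (cy ζ) / 2 - ((a : ℂ) ^ 2 + b ^ 2))) * hwn
      + c₃ * n / 2 * hy2 + n * c₃ * hRc
  have h3 : (c₃ : ℂ) ≠ 0 := by
    intro h3
    rw [h3, zero_mul] at h23
    have h2 : (c₂ : ℂ) = 0 := by
      have hn' : (n : ℂ) ≠ 0 := by exact_mod_cast hn0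
      simpa [hn'] using h23.symm
    rcases hc with h | h | h
    · exact h rfl
    · exact h (by exact_mod_cast h2)
    · exact h (by exact_mod_cast h3)
  have hrot : (ζ.1 2 : ℂ) * R ^ 2 * n * 2
      = - cz ζ * (n * (conj (cy ζ) * cw ζ + cy ζ * conj (cw ζ)) + R ^ 2 * (cw ζ + conj (cw ζ))) := by
    have h := hC _ (rotation_mem_tangentP6 ζ 0 (cw ζ) 0)
    rw [fderiv_G, fderiv_H, fderiv_K] at h
    simp only [hx, hzc, cw_ofComplex, cx_ofComplex, cy_ofComplex, cz_ofComplex, ofComplex_two,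
      map_zero, map_mul, map_add, map_neg, map_div₀, map_pow, map_ofNat, Complex.ofReal_zero,
      Complex.conj_conj] at h
    refine mul_left_cancel₀ h3 ?_
    linear_combination h - (c₂ * cz ζ * (cw ζ + conj (cw ζ)) + c₃ * (2 * ζ.1 2 * cz ζ ^ 2
      + cz ζ * (conj (cy ζ) * cw ζ + cy ζ * conj (cw ζ)))) * hwn
      + c₃ * 2 * ζ.1 2 * n * (hRc - hz2) + c₃ * cz ζ * (cw ζ + conj (cw ζ)) / 2 * hRc
      + cz ζ * (cw ζ + conj (cw ζ)) / 2 * h23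
  have hzre : cz ζ = ((cz ζ).re : ℂ) := (Complex.conj_eq_iff_re.1 hzc).symm
  have hzsq : (cz ζ).re ^ 2 = R ^ 2 := by
    rw [hzre] at hz2
    rw [hR]; exact_mod_cast hz2
  have hrot' : ζ.1 2 * R ^ 2 * n = - (cz ζ).re * ((R ^ 2 + n * (cy ζ).re) * (cw ζ).re
      + n * (cy ζ).im * (cw ζ).im) := by
    rw [hzre] at hrot
    have := congrArg Complex.re hrot
    simp [pow_two] at this
    linear_combination this / 2
  have hnw : (cw ζ).re ^ 2 + (cw ζ).im ^ 2 = n := by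
    rw [hn, Complex.sq_norm, Complex.normSq_apply]; ring
  have hsq : R ^ 2 * n * (R ^ 2 * n * ζ.1 2 ^ 2) = R ^ 2 * ((R ^ 2 + n * (cy ζ).re) * (cw ζ).re
      + n * (cy ζ).im * (cw ζ).im) ^ 2 := by
    linear_combination (ζ.1 2 * R ^ 2 * n - (cz ζ).re * ((R ^ 2 + n * (cy ζ).re) * (cw ζ).re
      + n * (cy ζ).im * (cw ζ).im)) * hrot' + ((R ^ 2 + n * (cy ζ).re) * (cw ζ).re
      + n * (cy ζ).im * (cw ζ).im) ^ 2 * hzsq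
  have hRn : 0 < R ^ 2 * n := by positivity
  have hle : R ^ 2 * n * (R ^ 2 * n * ζ.1 2 ^ 2)
      ≤ R ^ 2 * n * ((R ^ 2 + n * (cy ζ).re) ^ 2 + (n * (cy ζ).im) ^ 2) := by
    rw [hsq]
    have : 0 ≤ R ^ 2 * ((R ^ 2 + n * (cy ζ).re) * (cw ζ).im - n * (cy ζ).im * (cw ζ).re) ^ 2 := by
      positivity
    linear_combination this
      + R ^ 2 * ((R ^ 2 + n * (cy ζ).re) ^ 2 + (n * (cy ζ).im) ^ 2) * hnw
  have := le_of_mul_le_mul_left hle hRn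
  linarith

/-- A point with `2G - p²H = -r²√K` and `x ≠ 0` carries the data of `Sep`. The relation says that
`(ρ t - 2 Re (z v))² = (r (u + ū))²`, and the sign of `u` is chosen accordingly. -/
lemma exists_sep (hb : 0 < b) (hab : b < a) (hζ : ζ ∈ P6 a b) (hx : cx ζ ≠ 0)
    (hΨ : 2 * G a b ζ - (a ^ 2 + b ^ 2) * H ζ = - r a b ^ 2 * ‖cw ζ ^ 2 + cx ζ‖) :
    ∃ (ρ : ℝ) (ϑ v u : ℂ), cx ζ = ρ * ϑ ∧ cw ζ = ϑ * v ∧ ϑ * conj ϑ = 1 ∧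
      ‖u‖ ^ 2 = ‖cw ζ ^ 2 + cx ζ‖ ∧
      Sep a b (r a b) ρ (ζ.1 2) (H ζ) u v (cx ζ) (cy ζ) (cz ζ) := by
  have hR := r_sq hb hab
  have hRpos := r_pos hb hab
  have hRc : (r a b : ℂ) ^ 2 = (a : ℂ) ^ 2 - b ^ 2 := by exact_mod_cast hR
  obtain ⟨h1, h2⟩ := mem_P6_iff.1 hζ
  set R := r a b
  set ρ := ‖cx ζ‖ with hρdef
  have hρ : 0 < ρ := norm_pos_iff.2 hx
  have hρc : (ρ : ℂ) ≠ 0 := by exact_mod_cast hρ.ne'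
  set ϑ := cx ζ / ρ with hϑdef
  have hxϑ : cx ζ = ρ * ϑ := by rw [hϑdef]; field_simp
  have hxρ : cx ζ * conj (cx ζ) = (ρ : ℂ) ^ 2 := Complex.mul_conj' _
  have hϑ : ϑ * conj ϑ = 1 := by
    rw [hϑdef]; simp only [map_div₀, Complex.conj_ofReal]; field_simp; exact hxρ
  set v := conj ϑ * cw ζ with hvdef
  have hw : cw ζ = ϑ * v := by rw [hvdef, ← mul_assoc, hϑ, one_mul]
  obtain ⟨u₀, hu₀⟩ := IsAlgClosed.exists_pow_nat_eq (v ^ 2 + ρ * conj ϑ) (n := 2) (by norm_num)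
  have hξ : cw ζ ^ 2 + cx ζ = ϑ ^ 2 * u₀ ^ 2 := by
    rw [hu₀, hw, hxϑ]; linear_combination - ρ * ϑ * hϑ
  have hϑn : ‖ϑ‖ = 1 := by
    rw [Complex.mul_conj'] at hϑ
    have : ‖ϑ‖ ^ 2 = 1 := by exact_mod_cast hϑ
    exact (pow_eq_one_iff_of_nonneg (norm_nonneg _) two_ne_zero).1 this
  have hκ : ‖u₀‖ ^ 2 = ‖cw ζ ^ 2 + cx ζ‖ := by
    rw [hξ, norm_mul, norm_pow, norm_pow, hϑn]; ring
  have hL := two_G_sub_eq hζ hρ.ne' hϑ hxϑ hw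
  have hΨc : 2 * (G a b ζ : ℂ) - ((a : ℂ) ^ 2 + b ^ 2) * H ζ = - R ^ 2 * (u₀ * conj u₀) := by
    rw [Complex.mul_conj', ← Complex.ofReal_pow ‖u₀‖, hκ]
    exact_mod_cast hΨ
  rw [hΨc, ← hu₀, map_pow, ← hRc] at hL
  have hsq : (ρ * ζ.1 2 - (cz ζ * v + conj (cz ζ) * conj v)) ^ 2
      = (R * (u₀ + conj u₀)) ^ 2 := by linear_combination 2 * hL
  have hx' : conj (cx ζ) = u₀ ^ 2 - v ^ 2 := by
    rw [hu₀, hxϑ]; simp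
  have hh : (H ζ : ℂ) = v * conj v + (ζ.1 2 : ℂ) ^ 2 / 2 - (cy ζ + conj (cy ζ)) / 2 := by
    rw [H_eq, hw, map_mul]; linear_combination v * conj v * hϑ
  rcases sq_eq_sq_iff_eq_or_eq_neg.1 hsq with h | h
  · exact ⟨ρ, ϑ, v, u₀, hxϑ, hw, hϑ, hκ, hR, hρ, hx', hxρ, by rw [h1, hRc], h2,
      by linear_combination h, hh⟩
  · exact ⟨ρ, ϑ, v, -u₀, hxϑ, hw, hϑ, by rw [norm_neg, hκ], hR, hρ, by rw [hx']; ring, hxρ,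
      by rw [h1, hRc], h2, by rw [map_neg]; linear_combination h, hh⟩

lemma norm_le_H_add_two_b (hb : 0 < b) (hab : b < a) (hζ : ζ ∈ P6 a b)
    (hΨ : 2 * G a b ζ - (a ^ 2 + b ^ 2) * H ζ = - r a b ^ 2 * ‖cw ζ ^ 2 + cx ζ‖) :
    ‖cw ζ ^ 2 + cx ζ‖ ≤ H ζ + 2 * b := by
  by_cases hx : cx ζ = 0
  · exact kappa_le_of_cx_eq_zero hb hab hζ hx
  · obtain ⟨ρ, ϑ, v, u, -, -, -, hκ, S⟩ := exists_sep hb hab hζ hx hΨ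
    exact hκ ▸ S.kappa_le hb

lemma quadratic_nonneg (hb : 0 < b) (hab : b < a) (hζ : ζ ∈ P6 a b)
    (hΨ : 2 * G a b ζ - (a ^ 2 + b ^ 2) * H ζ = - r a b ^ 2 * ‖cw ζ ^ 2 + cx ζ‖)
    (hr : rankJ a b ζ < 3) :
    0 ≤ 2 * (a ^ 2 + b ^ 2) * ‖cw ζ ^ 2 + cx ζ‖ ^ 2
      - 2 * r a b ^ 2 * H ζ * ‖cw ζ ^ 2 + cx ζ‖ + r a b ^ 4 := by
  by_cases hx : cx ζ = 0
  · exact quadratic_nonneg_of_cx_eq_zero hb hab hζ hx hr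
  obtain ⟨ρ, ϑ, v, u, hxϑ, hw, hϑ, hκ, S⟩ := exists_sep hb hab hζ hx hΨ
  rw [← hκ]
  by_cases hu : u + conj u = 0
  · exact S.quadratic_nonneg_of_re_add hu
  obtain ⟨c₁, c₂, c₃, hc, hδ⟩ := rankJ_lt_three_iff.1 hr
  have hf : ((r a b * (2 * u.re) : ℝ) : ℂ) = r a b * (u + conj u) := by
    rw [Complex.add_conj]; push_cast; ring
  have hη : v ^ 2 + ρ * conj ϑ = u ^ 2 := by
    have := S.hx
    rw [hxϑ, map_mul, Complex.conj_ofReal] at this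
    rw [this]; ring
  obtain ⟨E1, E2, E3⟩ := lagrange_equations hζ S.hρ.ne' hϑ hxϑ hw (f := r a b * (2 * u.re))
    (by rw [hf]; linear_combination -S.ht) hδ
  have hϑ' : ρ * conj ϑ = conj (cx ζ) := by rw [hxϑ]; simp
  rw [hη, ← S.hRc] at E2 E3
  refine S.quadratic_nonneg_of_lagrange hc hϑ' hf ?_ E1 E2 ?_
  · have hR := (r_pos hb hab).ne'
    intro h0
    rw [h0] at hf
    refine (mul_ne_zero ?_ hu) hf.symm
    exact_mod_cast hR
  · rw [← hϑ']
    linear_combination E3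

end vanishing

/-! ### A family of critical points -/

section construction

variable {a b : ℝ}

/-- Points where `F = 0` and `x̄ (w² + x) = s x` with `s` real are critical, since
`2 s d(2G - p²H) = r² dK` on the tangent space, and their values lie on `Σ₂`. -/
lemma rank_and_G_of_second_system (hb : 0 < b) (hab : b < a) {ζ : Ambient} (hζ : ζ ∈ P6 a b)
    (hx : cx ζ ≠ 0) {s : ℝ} (hs : conj (cx ζ) * (cw ζ ^ 2 + cx ζ) = s * cx ζ)
    (hF : cx ζ * conj (cx ζ) * ζ.1 2
      = conj (cx ζ) * cz ζ * cw ζ + cx ζ * conj (cz ζ) * conj (cw ζ)) :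
    rankJ a b ζ < 3 ∧ K ζ = s ^ 2 ∧ 2 * G a b ζ - (a ^ 2 + b ^ 2) * H ζ = r a b ^ 2 * s := by
  have hR := r_sq hb hab
  have hRpos := r_pos hb hab
  have hRc : (r a b : ℂ) ^ 2 = (a : ℂ) ^ 2 - b ^ 2 := by exact_mod_cast hR
  have hx' : conj (cx ζ) ≠ 0 := by simpa using hx
  have hs' : cx ζ * conj (cw ζ ^ 2 + cx ζ) = s * conj (cx ζ) := by
    simpa using congrArg conj hs
  have hn : cx ζ * conj (cx ζ) ≠ 0 := mul_ne_zero hx hx'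
  have hL : 2 * (G a b ζ : ℂ) - ((a : ℂ) ^ 2 + b ^ 2) * H ζ = r a b ^ 2 * s := by
    have h := normSq_cx_mul hζ
    rw [hF, ← hRc] at h
    refine mul_left_cancel₀ hn ?_
    linear_combination h + (r a b : ℂ) ^ 2 / 2 * (conj (cx ζ) * hs + cx ζ * hs')
  refine ⟨?_, ?_, by exact_mod_cast hL⟩
  · refine rankJ_lt_three_iff.2 ⟨0, -r a b ^ 2, 2 * s, Or.inr (Or.inl ?_), fun δ hδ => ?_⟩
    · exact neg_ne_zero.2 (pow_ne_zero 2 hRpos.ne')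
    · have h := normSq_cx_mul_fderiv hζ hδ
      rw [hF, hL, sub_self, ← hRc] at h
      have hfin : (0 : ℂ) * fderiv ℝ H ζ δ + -(r a b : ℂ) ^ 2 * fderiv ℝ K ζ δ
        + 2 * s * (2 * fderiv ℝ (G a b) ζ δ - ((a : ℂ) ^ 2 + b ^ 2) * fderiv ℝ H ζ δ) = 0 := by
        refine (mul_eq_zero.1 (?_ : cx ζ * conj (cx ζ) * _ = 0)).resolve_left hn
        rw [fderiv_K]
        simp only [map_add, map_mul, map_pow, map_ofNat] at h hs' ⊢
        linear_combination 2 * s * h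
          + (r a b : ℂ) ^ 2 * (2 * s * conj (cx δ)
            - cx ζ * (2 * conj (cw ζ) * conj (cw δ) + conj (cx δ))) * hs
          + (r a b : ℂ) ^ 2 * (2 * s * cx δ
            - conj (cx ζ) * (2 * cw ζ * cw δ + cx δ)) * hs'
      exact_mod_cast hfin
  · have h : (K ζ : ℂ) = s ^ 2 := by
      refine mul_left_cancel₀ hn ?_
      rw [K_eq]
      linear_combination (cx ζ * conj (cw ζ ^ 2 + cx ζ)) * hs + s * cx ζ * hs'
    exact_mod_cast h

/-- Critical points over `Σ₂` from parameters: the point constructed has `|x| = ρ = r² / e`,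
`Re x = ρ ξ`, `|z|² = T ρ - ρ²`, `|w|² = ρ d` and `x̄ (w² + x) = r² m x`. The inequalities on `T ± e`
say that `(Re z)²` and `(Im z)²` are nonnegative. -/
lemma exists_second_system_point (hb : 0 < b) (hab : b < a) {e T d ξ m h : ℝ} (he : 0 < e)
    (hd : 0 ≤ d) (hξ : ξ ^ 2 ≤ 1) (hdξ : d ^ 2 = (m * e) ^ 2 - 2 * (m * e) * ξ + 1)
    (hB₁ : -(2 * b) ≤ T - e) (hB₂ : T - e ≤ 2 * b) (hA : 2 * a ≤ T + e)
    (hh : h = d * T + m / 2 * (T ^ 2 - 2 * (a ^ 2 + b ^ 2) + e ^ 2) - e * ξ) :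
    ∃ ζ ∈ criticalSet a b, H ζ = h ∧ K ζ = (r a b ^ 2 * m) ^ 2 ∧
      2 * G a b ζ - (a ^ 2 + b ^ 2) * h = r a b ^ 2 * (r a b ^ 2 * m) := by
  have hR := r_sq hb hab
  have hRpos := r_pos hb hab
  have hRc : (r a b : ℂ) ^ 2 = (a : ℂ) ^ 2 - b ^ 2 := by exact_mod_cast hR
  set R := r a b with hRdef
  obtain ⟨ρ, hρe⟩ : ∃ ρ, ρ * e = R ^ 2 := ⟨R ^ 2 / e, by field_simp⟩
  have hρ : 0 < ρ := by
    have : 0 < ρ * e := by rw [hρe]; positivity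
    exact pos_of_mul_pos_left this he.le
  have hρc : (ρ : ℂ) ≠ 0 := by exact_mod_cast hρ.ne'
  -- `|z|² = Z` and `Re z² = Y`
  obtain ⟨Z, hZ⟩ : ∃ Z, Z = T * ρ - ρ ^ 2 := ⟨_, rfl⟩
  obtain ⟨Y, hY⟩ : ∃ Y, 2 * R ^ 2 * Y = ρ ^ 2 * (T ^ 2 - 2 * (a ^ 2 + b ^ 2) + e ^ 2) :=
    ⟨ρ ^ 2 * (T ^ 2 - 2 * (a ^ 2 + b ^ 2) + e ^ 2) / (2 * R ^ 2), by field_simp⟩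
  have hYZ₁ : 0 ≤ (Z + Y) / 2 := by
    have h1 : 4 * R ^ 2 * ((Z + Y) / 2) = ρ ^ 2 * ((T + e) ^ 2 - (2 * a) ^ 2) := by
      rw [hZ]; linear_combination hY - 2 * ρ * T * hρe - 2 * ρ ^ 2 * hR
    have h2 : 0 ≤ ρ ^ 2 * ((T + e) ^ 2 - (2 * a) ^ 2) := by
      have : (2 * a) ^ 2 ≤ (T + e) ^ 2 := pow_le_pow_left₀ (by linarith) hA 2
      exact mul_nonneg (sq_nonneg _) (by linarith)
    rw [← h1] at h2
    exact nonneg_of_mul_nonneg_right h2 (by positivity)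
  have hYZ₂ : 0 ≤ (Z - Y) / 2 := by
    have h1 : 4 * R ^ 2 * ((Z - Y) / 2) = ρ ^ 2 * ((2 * b) ^ 2 - (T - e) ^ 2) := by
      rw [hZ]; linear_combination -hY - 2 * ρ * T * hρe - 2 * ρ ^ 2 * hR
    have h2 : 0 ≤ ρ ^ 2 * ((2 * b) ^ 2 - (T - e) ^ 2) := by
      have : (T - e) ^ 2 ≤ (2 * b) ^ 2 := sq_le_sq' hB₁ hB₂
      exact mul_nonneg (sq_nonneg _) (by linarith)
    rw [← h1] at h2
    exact nonneg_of_mul_nonneg_right h2 (by positivity)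
  obtain ⟨x, hxre, hxn⟩ : ∃ x : ℂ, x + conj x = 2 * ρ * ξ ∧ x * conj x = (ρ : ℂ) ^ 2 := by
    refine ⟨⟨ρ * ξ, ρ * √(1 - ξ ^ 2)⟩, ?_, ?_⟩
    · rw [Complex.add_conj]; push_cast; ring
    · rw [Complex.mul_conj, Complex.normSq_mk]
      have := Real.sq_sqrt (show 0 ≤ 1 - ξ ^ 2 by linarith)
      norm_cast
      linear_combination ρ ^ 2 * this
  obtain ⟨z, hzz, hzn⟩ : ∃ z : ℂ, z ^ 2 + conj z ^ 2 = 2 * Y ∧ z * conj z = Z := by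
    have h1 := Real.sq_sqrt hYZ₁
    have h2 := Real.sq_sqrt hYZ₂
    refine ⟨⟨√((Z + Y) / 2), √((Z - Y) / 2)⟩, ?_, ?_⟩
    · apply Complex.ext
      · simp [pow_two] at h1 h2 ⊢
        linarith
      · simp [pow_two]; ring
    · rw [Complex.mul_conj, Complex.normSq_mk]
      norm_cast
      linarith
  have hx0 : x ≠ 0 := by
    rintro rfl
    rw [zero_mul] at hxn
    exact pow_ne_zero 2 hρc hxn.symm
  have hx0' : conj x ≠ 0 := by simpa using hx0
  obtain ⟨v, hv⟩ := IsAlgClosed.exists_pow_nat_eq ((R ^ 2 * m : ℝ) - conj x : ℂ) (n := 2)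
    (by norm_num)
  have hv' : conj v ^ 2 = (R ^ 2 * m : ℝ) - x := by
    rw [← map_pow, hv, map_sub, Complex.conj_conj, Complex.conj_ofReal]
  have hs : ((R ^ 2 * m : ℝ) : ℂ) = ρ * (m * e) := by
    rw [← hρe]; push_cast; ring
  have hvn : v * conj v = ρ * d := by
    have h1 : (v * conj v) ^ 2 = (ρ * d : ℝ) ^ 2 := by
      have hdc : (d : ℂ) ^ 2 = (m * e) ^ 2 - 2 * (m * e) * ξ + 1 := by exact_mod_cast hdξ
      rw [mul_pow, hv, hv', hs]; push_cast
      linear_combination hxn - ρ * m * e * hxre - ρ ^ 2 * hdc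
    rw [Complex.mul_conj'] at h1 ⊢
    have h2 : (‖v‖ ^ 2) ^ 2 = (ρ * d) ^ 2 := by exact_mod_cast h1
    rw [sq_eq_sq₀ (by positivity) (by positivity)] at h2
    exact_mod_cast h2
  obtain ⟨y, hy⟩ : ∃ y, x * conj y = R ^ 2 - z ^ 2 :=
    ⟨conj ((R ^ 2 - z ^ 2) / x), by rw [Complex.conj_conj]; field_simp⟩
  have hy' : conj x * y = R ^ 2 - conj z ^ 2 := by simpa using congrArg conj hy
  obtain ⟨t, ht⟩ : ∃ t : ℝ, (ρ * t : ℂ) = z * v + conj z * conj v := by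
    refine ⟨2 * (z * v).re / ρ, ?_⟩
    rw [← map_mul, Complex.add_conj]; push_cast; field_simp
  set ζ := ofComplex (x / ρ * v) t x y z with hζdef
  have ew : cw ζ = x / ρ * v := cw_ofComplex _ _ _ _ _
  have et : ζ.1 2 = t := ofComplex_two _ _ _ _ _
  have ex : cx ζ = x := cx_ofComplex _ _ _ _ _
  have ey : cy ζ = y := cy_ofComplex _ _ _ _ _
  have ez : cz ζ = z := cz_ofComplex _ _ _ _ _
  have hZc : (Z : ℂ) = T * ρ - ρ ^ 2 := by exact_mod_cast hZ
  have hYc : 2 * (R : ℂ) ^ 2 * Y = ρ ^ 2 * (T ^ 2 - 2 * ((a : ℂ) ^ 2 + b ^ 2) + e ^ 2) := by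
    exact_mod_cast hY
  have hρec : (ρ : ℂ) * e = R ^ 2 := by exact_mod_cast hρe
  have hζ : ζ ∈ P6 a b := by
    rw [mem_P6_iff, ex, ey, ez]
    refine ⟨by rw [hy, ← hRc]; ring, ?_⟩
    refine mul_left_cancel₀ (pow_ne_zero 2 hρc) ?_
    linear_combination (ρ : ℂ) ^ 2 * hxn - y * conj y * hxn + conj x * y * hy
      + (R ^ 2 - z ^ 2) * hy' + (z * conj z + Z + 2 * ρ ^ 2) * hzn - R ^ 2 * hzz - hYc
      + (ρ ^ 2 + Z + ρ * T) * hZc - (ρ * e + R ^ 2) * hρec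
  have hH : H ζ = h := by
    have hhc : (h : ℂ) = d * T + m / 2 * (T ^ 2 - 2 * ((a : ℂ) ^ 2 + b ^ 2) + e ^ 2) - e * ξ := by
      rw [hh]; push_cast; ring
    have : (H ζ : ℂ) = h := by
      rw [H_eq, ew, et, ey, map_mul, map_div₀, Complex.conj_ofReal]
      refine mul_left_cancel₀ (pow_ne_zero 2 hρc) ?_
      field_simp
      push_cast at hv hv'
      linear_combination 2 * v * conj v * hxn + (ρ * t + z * v + conj z * conj v) * ht
        + (y + conj y) * hxn - conj x * hy - x * hy' + z ^ 2 * hv + conj z ^ 2 * hv'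
        + 2 * v * conj v * (hzn + hZc) + 2 * T * ρ * hvn + R ^ 2 * m * hzz + m * hYc
        - R ^ 2 * hxre - 2 * ρ ^ 2 * hhc + 2 * ρ * ξ * hρec
    exact_mod_cast this
  obtain ⟨h1, h2, h3⟩ := rank_and_G_of_second_system hb hab hζ (s := R ^ 2 * m) (ex ▸ hx0)
    (by
      rw [ex, ew]
      field_simp
      linear_combination v ^ 2 * hxn + ρ ^ 2 * hv)
    (by
      rw [ex, ew, et, ez, map_mul, map_div₀, Complex.conj_ofReal]
      field_simp
      linear_combination ht)
  exact ⟨ζ, ⟨hζ, h1⟩, hH, h2, hH ▸ h3⟩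

end construction

/-! ### Existence of critical points and description of the diagram -/

section parameters

variable {a b h m ℓ A B : ℝ}

/-- Critical points over `Σ₂` from the separated variables `A = T + e` and `B = T - e`; with
`d = ℓ - m T`, the condition `|ξ| ≤ 1` on the phase of `x` becomes
`(1 - (ℓ - m A)²) ((ℓ - m B)² - 1) ≥ 0`. -/
lemma exists_point_of_separation (hb : 0 < b) (hab : b < a) (hm : m ≠ 0)
    (hℓ : ℓ ^ 2 = 2 * (a ^ 2 + b ^ 2) * m ^ 2 + 2 * h * m + 1)
    (hA : 2 * a ≤ A) (hB₁ : -(2 * b) ≤ B) (hB₂ : B ≤ 2 * b)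
    (hd : 0 ≤ (ℓ - m * A) + (ℓ - m * B))
    (hA₂ : (ℓ - m * A) ^ 2 ≤ 1 ∧ 1 ≤ (ℓ - m * B) ^ 2 ∨
      1 ≤ (ℓ - m * A) ^ 2 ∧ (ℓ - m * B) ^ 2 ≤ 1) :
    ∃ ζ ∈ criticalSet a b, H ζ = h ∧ K ζ = (r a b ^ 2 * m) ^ 2 ∧
      2 * G a b ζ - (a ^ 2 + b ^ 2) * h = r a b ^ 2 * (r a b ^ 2 * m) := by
  obtain ⟨e, he⟩ : ∃ e, e = (A - B) / 2 := ⟨_, rfl⟩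
  obtain ⟨T, hT⟩ : ∃ T, T = (A + B) / 2 := ⟨_, rfl⟩
  obtain ⟨d, hdd⟩ : ∃ d, d = ℓ - m * T := ⟨_, rfl⟩
  have hepos : 0 < e := by rw [he]; linarith
  have hme : 2 * (m * e) ≠ 0 := mul_ne_zero two_ne_zero (mul_ne_zero hm hepos.ne')
  obtain ⟨ξ, hξ⟩ : ∃ ξ, 2 * (m * e) * ξ = (m * e) ^ 2 + 1 - d ^ 2 :=
    ⟨((m * e) ^ 2 + 1 - d ^ 2) / (2 * (m * e)), by field_simp⟩
  have e1 : ℓ - m * A = d - m * e := by rw [hdd, hT, he]; ring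
  have e2 : ℓ - m * B = d + m * e := by rw [hdd, hT, he]; ring
  rw [e1, e2] at hA₂
  have hprod : (1 - (d - m * e) ^ 2) * ((d + m * e) ^ 2 - 1) = (2 * (m * e)) ^ 2 * (1 - ξ ^ 2) := by
    linear_combination (2 * (m * e) * ξ + ((m * e) ^ 2 + 1 - d ^ 2)) * hξ
  have hξ1 : ξ ^ 2 ≤ 1 := by
    have h0 : 0 ≤ (2 * (m * e)) ^ 2 * (1 - ξ ^ 2) := by
      rw [← hprod]
      rcases hA₂ with ⟨h1, h2⟩ | ⟨h1, h2⟩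
      · exact mul_nonneg (by linarith) (by linarith)
      · exact mul_nonneg_of_nonpos_of_nonpos (by linarith) (by linarith)
    have := nonneg_of_mul_nonneg_right h0 (by positivity)
    linarith
  refine exists_second_system_point hb hab (e := e) (T := T) (d := d) (ξ := ξ) hepos
    (by rw [hdd, hT]; linarith) hξ1 (by linarith) (by rw [hT, he]; linarith)
    (by rw [hT, he]; linarith) (by rw [hT, he]; linarith) ?_
  refine mul_left_cancel₀ hm ?_
  rw [hdd] at hξ ⊢
  linear_combination -hℓ / 2 + hξ / 2

lemma exists_critical_point (hb : 0 < b) (hab : b < a)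
    (hs₁ : r a b ^ 2 * m ≤ h + 2 * a) (hs₂ : -(r a b ^ 2 * m) ≤ h + 2 * b)
    (hq : 0 ≤ 2 * (a ^ 2 + b ^ 2) * m ^ 2 + 2 * h * m + 1) :
    ∃ ζ ∈ criticalSet a b, H ζ = h ∧ K ζ = (r a b ^ 2 * m) ^ 2 ∧
      2 * G a b ζ - (a ^ 2 + b ^ 2) * h = r a b ^ 2 * (r a b ^ 2 * m) := by
  have hR := r_sq hb hab
  obtain ⟨ℓ, hℓ⟩ : ∃ ℓ, ℓ = √(2 * (a ^ 2 + b ^ 2) * m ^ 2 + 2 * h * m + 1) := ⟨_, rfl⟩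
  have hℓ0 : 0 ≤ ℓ := by rw [hℓ]; positivity
  have hℓ2 : ℓ ^ 2 = 2 * (a ^ 2 + b ^ 2) * m ^ 2 + 2 * h * m + 1 := by rw [hℓ, Real.sq_sqrt hq]
  rw [hR] at hs₁ hs₂
  rcases lt_trichotomy m 0 with hm | rfl | hm
  · have hle : ℓ ≤ 1 - 2 * b * m := by
      refine abs_le_of_sq_le_sq' ?_ (by nlinarith) |>.2
      nlinarith
    have hmi : 0 < -m := by linarith
    -- `A` can be taken so large that `ℓ - m A ≥ 1`; the bound on `ℓ` leaves room for `B`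
    obtain ⟨A, hA1, hA2⟩ : ∃ A, 2 * a ≤ A ∧ 1 ≤ -m * A := by
      refine ⟨max (2 * a) (1 / -m), le_max_left _ _, ?_⟩
      calc (1 : ℝ) = -m * (1 / -m) := by rw [← mul_div_assoc, mul_div_cancel_left₀ _ hmi.ne']
        _ ≤ _ := mul_le_mul_of_nonneg_left (le_max_right _ _) hmi.le
    obtain ⟨B, hB1, hB2, hB3, hB4⟩ : ∃ B, -(2 * b) ≤ B ∧ B ≤ 2 * b ∧ -1 - ℓ ≤ -m * B ∧
        -m * B ≤ 1 - ℓ := by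
      have h0 : (-1 - ℓ) / -m ≤ 0 := div_nonpos_of_nonpos_of_nonneg (by linarith) hmi.le
      have h1 : -m * ((-1 - ℓ) / -m) = -1 - ℓ := by
        rw [← mul_div_assoc, mul_div_cancel_left₀ _ hmi.ne']
      rcases le_total (-(2 * b)) ((-1 - ℓ) / -m) with hle' | hle'
      · exact ⟨(-1 - ℓ) / -m, hle', by linarith, h1.ge, by rw [h1]; linarith⟩
      · refine ⟨-(2 * b), le_rfl, by linarith, ?_, by nlinarith⟩
        rw [← h1]
        exact mul_le_mul_of_nonneg_left hle' hmi.le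
    refine exists_point_of_separation hb hab hm.ne hℓ2 hA1 hB1 hB2 (by linarith) (Or.inr ⟨?_, ?_⟩)
    · nlinarith
    · rw [sq_le_one_iff_abs_le_one, abs_le]; constructor <;> linarith
  · -- here `K = 0`, and `ξ` is solved for directly: `h` is attained with `B = -2b` for large `A`
    obtain ⟨A, hA1, hA2⟩ : ∃ A, 2 * a ≤ A ∧ h ≤ A :=
      ⟨max (2 * a) h, le_max_left _ _, le_max_right _ _⟩
    have he : 0 < (A + 2 * b) / 2 := by linarith
    refine exists_second_system_point hb hab (e := (A + 2 * b) / 2) (T := (A - 2 * b) / 2) (d := 1)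
      (ξ := ((A - 2 * b) / 2 - h) / ((A + 2 * b) / 2)) he zero_le_one ?_ (by ring)
      (by linarith) (by linarith) (by linarith) ?_
    · rw [sq_le_one_iff_abs_le_one, abs_le, div_le_one he, le_div_iff₀ he]
      constructor <;> linarith
    · have e : (A + 2 * b) / 2 * (((A - 2 * b) / 2 - h) / ((A + 2 * b) / 2))
          = (A - 2 * b) / 2 - h := by rw [← mul_div_assoc, mul_div_cancel_left₀ _ he.ne']
      rw [e]; ring
  · -- here `B = -2b`, and `A` is the least value `≥ 2a` with `ℓ - m A ≤ 1`
    have h1 : |2 * a * m - 1| ≤ ℓ := by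
      rw [hℓ]; apply Real.abs_le_sqrt; nlinarith
    have h2 : |2 * b * m - 1| ≤ ℓ := by
      rw [hℓ]; apply Real.abs_le_sqrt; nlinarith
    rw [abs_le] at h1 h2
    obtain ⟨A, hA1, hA2, hA3⟩ : ∃ A, 2 * a ≤ A ∧ ℓ - 1 ≤ m * A ∧ m * A ≤ ℓ + 1 := by
      have h0 : m * ((ℓ - 1) / m) = ℓ - 1 := by field_simp
      rcases le_total (2 * a) ((ℓ - 1) / m) with hle | hle
      · exact ⟨(ℓ - 1) / m, hle, h0.ge, by rw [h0]; linarith⟩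
      · refine ⟨2 * a, le_rfl, ?_, by linarith⟩
        rw [← h0]
        exact mul_le_mul_of_nonneg_left hle hm.le
    have hB : 1 ≤ ℓ - m * (-(2 * b)) := by linarith
    refine exists_point_of_separation hb hab hm.ne' hℓ2 hA1 le_rfl (by linarith) (by linarith)
      (Or.inl ⟨?_, ?_⟩)
    · rw [sq_le_one_iff_abs_le_one, abs_le]; constructor <;> linarith
    · nlinarith

end parameters

/-- The critical values on `Σ₂`, in terms of `h` and the coordinate `m` with `2g - p²h = r⁴m`. -/
lemma mem_bifurcationDiagram_iff {a b h k g m : ℝ} (hb : 0 < b) (hab : b < a)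
    (hm : 2 * g - (a ^ 2 + b ^ 2) * h = r a b ^ 2 * (r a b ^ 2 * m))
    (hk : k = (r a b ^ 2 * m) ^ 2) :
    (h, k, g) ∈ bifurcationDiagram a b ↔
      -(a + b) ≤ h ∧ r a b ^ 2 * m ≤ h + 2 * a ∧ -(r a b ^ 2 * m) ≤ h + 2 * b ∧
        0 ≤ 2 * (a ^ 2 + b ^ 2) * m ^ 2 + 2 * h * m + 1 := by
  have hR := r_sq hb hab
  have hRpos := r_pos hb hab
  constructor
  · rintro ⟨ζ, ⟨hζ, hr⟩, hJ⟩
    simp only [J, Prod.mk.injEq] at hJ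
    obtain ⟨rfl, hK, rfl⟩ := hJ
    have hlow := neg_add_le_H hb hab hζ
    have h1 := norm_le_H_add hb hab hζ
    have h2 := neg_norm_le_H_add hb hab hζ
    have hκ0 : 0 ≤ ‖cw ζ ^ 2 + cx ζ‖ := norm_nonneg _
    have hKκ := K_eq_norm_sq ζ
    rw [hK, hk, sq_eq_sq_iff_eq_or_eq_neg] at hKκ
    rcases hKκ with hκ | hκ
    · have hm0 : 0 ≤ m := by
        rw [← hκ] at hκ0
        exact nonneg_of_mul_nonneg_right hκ0 (by positivity)
      refine ⟨hlow, by linarith, by linarith, ?_⟩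
      -- `h ≥ -(a + b)` and `m ≥ 0` bound the quadratic below by a sum of squares
      have : 0 ≤ ((a + b) * m - 1) ^ 2 + (a - b) ^ 2 * m ^ 2 := by positivity
      nlinarith
    · have hκ' : ‖cw ζ ^ 2 + cx ζ‖ = -(r a b ^ 2 * m) := by linarith
      have hΨ : 2 * G a b ζ - (a ^ 2 + b ^ 2) * H ζ = - r a b ^ 2 * ‖cw ζ ^ 2 + cx ζ‖ := by
        rw [hκ', hm]; ring
      refine ⟨hlow, by linarith, hκ' ▸ norm_le_H_add_two_b hb hab hζ hΨ, ?_⟩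
      have h3 := quadratic_nonneg hb hab hζ hΨ hr
      rw [hκ'] at h3
      have h4 : 0 ≤ r a b ^ 4 * (2 * (a ^ 2 + b ^ 2) * m ^ 2 + 2 * H ζ * m + 1) := by
        linear_combination h3
      exact nonneg_of_mul_nonneg_right h4 (by positivity)
  · rintro ⟨-, h1, h2, h3⟩
    obtain ⟨ζ, hζ, eH, eK, eG⟩ := exists_critical_point hb hab h1 h2 h3
    refine ⟨ζ, hζ, ?_⟩
    simp only [J, Prod.mk.injEq]
    exact ⟨eH, by rw [eK, hk], by linarith⟩

section branches

variable {a b h g m : ℝ}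

lemma le_gMinus_iff (hb : 0 < b) (hab : b < a)
    (hm : 2 * g - (a ^ 2 + b ^ 2) * h = r a b ^ 2 * (r a b ^ 2 * m)) :
    g ≤ gMinus a b h ↔
      2 * (a ^ 2 + b ^ 2) * m + h + √(h ^ 2 - 2 * (a ^ 2 + b ^ 2)) ≤ 0 := by
  have hR4 : 0 < r a b ^ 4 := pow_pos (r_pos hb hab) 4
  have hc : 0 < 4 * (a ^ 2 + b ^ 2) := by positivity
  have hp4 : p a b ^ 4 = (a ^ 2 + b ^ 2) ^ 2 := by rw [← p_sq]; ring
  rw [gMinus, hp4, p_sq, one_div, ← div_eq_inv_mul, le_div_iff₀ hc]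
  set q := √(h ^ 2 - 2 * (a ^ 2 + b ^ 2))
  have e : g * (4 * (a ^ 2 + b ^ 2))
      = ((2 * (a ^ 2 + b ^ 2) ^ 2 - r a b ^ 4) * h - r a b ^ 4 * q)
        + r a b ^ 4 * (2 * (a ^ 2 + b ^ 2) * m + h + q) := by
    linear_combination 2 * (a ^ 2 + b ^ 2) * hm
  rw [e, add_le_iff_nonpos_right]
  exact ⟨fun h' => nonpos_of_mul_nonpos_right h' hR4,
    fun h' => mul_nonpos_of_nonneg_of_nonpos hR4.le h'⟩

lemma gPlus_le_iff (hb : 0 < b) (hab : b < a)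
    (hm : 2 * g - (a ^ 2 + b ^ 2) * h = r a b ^ 2 * (r a b ^ 2 * m)) :
    gPlus a b h ≤ g ↔
      0 ≤ 2 * (a ^ 2 + b ^ 2) * m + h - √(h ^ 2 - 2 * (a ^ 2 + b ^ 2)) := by
  have hR4 : 0 < r a b ^ 4 := pow_pos (r_pos hb hab) 4
  have hc : 0 < 4 * (a ^ 2 + b ^ 2) := by positivity
  have hp4 : p a b ^ 4 = (a ^ 2 + b ^ 2) ^ 2 := by rw [← p_sq]; ring
  rw [gPlus, hp4, p_sq, one_div, ← div_eq_inv_mul, div_le_iff₀ hc]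
  set q := √(h ^ 2 - 2 * (a ^ 2 + b ^ 2))
  have e : g * (4 * (a ^ 2 + b ^ 2))
      = ((2 * (a ^ 2 + b ^ 2) ^ 2 - r a b ^ 4) * h + r a b ^ 4 * q)
        + r a b ^ 4 * (2 * (a ^ 2 + b ^ 2) * m + h - q) := by
    linear_combination 2 * (a ^ 2 + b ^ 2) * hm
  rw [e, le_add_iff_nonneg_right]
  exact ⟨fun h' => nonneg_of_mul_nonneg_right h' hR4, fun h' => mul_nonneg hR4.le h'⟩

lemma sqrt_two_mul_p_nonneg (a b : ℝ) : 0 ≤ √2 * p a b :=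
  mul_nonneg (Real.sqrt_nonneg _) (Real.sqrt_nonneg _)

lemma sq_sqrt_two_mul_p (a b : ℝ) : (√2 * p a b) ^ 2 = 2 * (a ^ 2 + b ^ 2) := by
  rw [mul_pow, Real.sq_sqrt (by norm_num), p_sq]

/-- For `h ≥ √2 p`, the quadratic is negative exactly strictly between the two branches. -/
lemma quadratic_nonneg_iff (hb : 0 < b) (hab : b < a)
    (hm : 2 * g - (a ^ 2 + b ^ 2) * h = r a b ^ 2 * (r a b ^ 2 * m)) (hh : √2 * p a b ≤ h) :
    0 ≤ 2 * (a ^ 2 + b ^ 2) * m ^ 2 + 2 * h * m + 1 ↔ g ≤ gMinus a b h ∨ gPlus a b h ≤ g := by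
  rw [le_gMinus_iff hb hab hm, gPlus_le_iff hb hab hm]
  have hdisc : 0 ≤ h ^ 2 - 2 * (a ^ 2 + b ^ 2) := by
    have := pow_le_pow_left₀ (sqrt_two_mul_p_nonneg a b) hh 2
    rw [sq_sqrt_two_mul_p] at this
    linarith
  obtain ⟨q, hq⟩ : ∃ q, q = √(h ^ 2 - 2 * (a ^ 2 + b ^ 2)) := ⟨_, rfl⟩
  have hq0 : 0 ≤ q := by rw [hq]; positivity
  have hq2 : q ^ 2 = h ^ 2 - 2 * (a ^ 2 + b ^ 2) := by rw [hq, Real.sq_sqrt hdisc]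
  have hfac : 2 * (a ^ 2 + b ^ 2) * (2 * (a ^ 2 + b ^ 2) * m ^ 2 + 2 * h * m + 1)
      = (2 * (a ^ 2 + b ^ 2) * m + h + q) * (2 * (a ^ 2 + b ^ 2) * m + h - q) := by
    linear_combination hq2
  have hc2 : 0 < 2 * (a ^ 2 + b ^ 2) := by positivity
  rw [← hq, ← mul_nonneg_iff_of_pos_left hc2, hfac, mul_nonneg_iff]
  constructor
  · rintro (⟨-, h2⟩ | ⟨h1, -⟩)
    · exact Or.inr h2
    · exact Or.inl h1
  · rintro (h1 | h2)
    · exact Or.inr ⟨h1, by linarith⟩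
    · exact Or.inl ⟨by linarith, h2⟩

lemma quadratic_nonneg_of_le (hb : 0 < b) (h1 : -(a + b) ≤ h)
    (h2 : h ≤ √2 * p a b) : 0 ≤ 2 * (a ^ 2 + b ^ 2) * m ^ 2 + 2 * h * m + 1 := by
  have hsq := sq_sqrt_two_mul_p a b
  have hle : a + b ≤ √2 * p a b := by
    refine abs_le_of_sq_le_sq' ?_ (sqrt_two_mul_p_nonneg a b) |>.2
    rw [hsq]; nlinarith [sq_nonneg (a - b)]
  have hh : h ^ 2 ≤ 2 * (a ^ 2 + b ^ 2) := by
    rw [← hsq]; exact sq_le_sq' (by linarith) h2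
  have hp : 0 < 2 * (a ^ 2 + b ^ 2) := by positivity
  refine nonneg_of_mul_nonneg_right (?_ : 0 ≤ 2 * (a ^ 2 + b ^ 2) * _) hp
  have : 0 ≤ (2 * (a ^ 2 + b ^ 2) * m + h) ^ 2 := sq_nonneg _
  linear_combination this + hh

lemma mem_bifurcationDiagram_iff_systems {k : ℝ} (hb : 0 < b) (hab : b < a)
    (hs : (h, k, g) ∈ surface2 a b) :
    (h, k, g) ∈ bifurcationDiagram a b ↔
      ((b ^ 2 * h - b * r a b ^ 2 ≤ g ∧ g ≤ a ^ 2 * h + a * r a b ^ 2 ∧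
          -(a + b) ≤ h ∧ h ≤ √2 * p a b) ∨
        (b ^ 2 * h - b * r a b ^ 2 ≤ g ∧ g ≤ gMinus a b h ∧ √2 * p a b ≤ h) ∨
        (gPlus a b h ≤ g ∧ g ≤ a ^ 2 * h + a * r a b ^ 2 ∧ √2 * p a b ≤ h)) := by
  have hR := r_sq hb hab
  have hRpos := r_pos hb hab
  have hR2 : 0 < r a b ^ 2 := by positivity
  have hpos := sqrt_two_mul_p_nonneg a b
  obtain ⟨m, hm⟩ : ∃ m, 2 * g - (a ^ 2 + b ^ 2) * h = r a b ^ 2 * (r a b ^ 2 * m) :=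
    ⟨(2 * g - (a ^ 2 + b ^ 2) * h) / r a b ^ 4, by field_simp⟩
  have hk : k = (r a b ^ 2 * m) ^ 2 := by
    have h1 : (2 * g - p a b ^ 2 * h) ^ 2 - r a b ^ 4 * k = 0 := hs
    rw [p_sq, hm] at h1
    refine mul_left_cancel₀ (pow_ne_zero 4 hRpos.ne') ?_
    linear_combination -h1
  have hupper : g ≤ a ^ 2 * h + a * r a b ^ 2 ↔ r a b ^ 2 * m ≤ h + 2 * a := by
    have e : r a b ^ 2 * (h + 2 * a - r a b ^ 2 * m) = 2 * (a ^ 2 * h + a * r a b ^ 2 - g) := by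
      linear_combination hm + h * hR
    rw [← sub_nonneg (b := r a b ^ 2 * m), ← mul_nonneg_iff_of_pos_left hR2
      (b := h + 2 * a - r a b ^ 2 * m), e, mul_nonneg_iff_of_pos_left two_pos, sub_nonneg]
  have hlower : b ^ 2 * h - b * r a b ^ 2 ≤ g ↔ -(r a b ^ 2 * m) ≤ h + 2 * b := by
    have e : r a b ^ 2 * (h + 2 * b - -(r a b ^ 2 * m))
        = 2 * (g - (b ^ 2 * h - b * r a b ^ 2)) := by
      linear_combination -hm + h * hR
    rw [← sub_nonneg (b := -(r a b ^ 2 * m)), ← mul_nonneg_iff_of_pos_left hR2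
      (b := h + 2 * b - -(r a b ^ 2 * m)), e, mul_nonneg_iff_of_pos_left two_pos, sub_nonneg]
  rw [mem_bifurcationDiagram_iff hb hab hm hk, hupper, hlower]
  constructor
  · rintro ⟨h1, h2, h3, h4⟩
    rcases le_total h (√2 * p a b) with hle | hle
    · exact Or.inl ⟨h3, h2, h1, hle⟩
    · rcases (quadratic_nonneg_iff hb hab hm hle).1 h4 with h5 | h5
      · exact Or.inr (Or.inl ⟨h3, h5, hle⟩)
      · exact Or.inr (Or.inr ⟨h5, h2, hle⟩)
  · rintro (⟨h3, h2, h1, hle⟩ | ⟨h3, h5, hle⟩ | ⟨h5, h2, hle⟩)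
    · exact ⟨h1, h2, h3, quadratic_nonneg_of_le hb h1 hle⟩
    · have hq := (quadratic_nonneg_iff hb hab hm hle).2 (Or.inl h5)
      rw [le_gMinus_iff hb hab hm] at h5
      have := Real.sqrt_nonneg (h ^ 2 - 2 * (a ^ 2 + b ^ 2))
      have hm0 : m ≤ 0 := by
        refine nonpos_of_mul_nonpos_right (?_ : 2 * (a ^ 2 + b ^ 2) * m ≤ 0) (by positivity)
        linarith
      have := mul_nonpos_of_nonneg_of_nonpos hR2.le hm0
      exact ⟨by linarith, by linarith, h3, hq⟩
    · have hq := (quadratic_nonneg_iff hb hab hm hle).2 (Or.inr h5)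
      rw [gPlus_le_iff hb hab hm] at h5
      have := Real.sqrt_nonneg (h ^ 2 - 2 * (a ^ 2 + b ^ 2))
      refine ⟨by linarith, h2, ?_, hq⟩
      rcases le_total 0 m with hm0 | hm0
      · have := mul_nonneg hR2.le hm0
        linarith
      · have : (a ^ 2 + 3 * b ^ 2) * m ≤ 0 := mul_nonpos_of_nonneg_of_nonpos (by positivity) hm0
        rw [hR]
        linarith

end branches

end KowalevskiTop

theorem theorem6 (a b : ℝ) (hb : 0 < b) (hab : b < a) :
    (∀ h k g : ℝ,
      (h, k, g) ∈ KowalevskiTop.surface2 a b ∩ KowalevskiTop.bifurcationDiagram a b →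
        -(a + b) ≤ h) ∧
    (∀ h k g : ℝ,
      (h, k, g) ∈ KowalevskiTop.surface2 a b ∩ KowalevskiTop.bifurcationDiagram a b ↔
        (h, k, g) ∈ KowalevskiTop.surface2 a b ∧
          ((b ^ 2 * h - b * KowalevskiTop.r a b ^ 2 ≤ g ∧
              g ≤ a ^ 2 * h + a * KowalevskiTop.r a b ^ 2 ∧
              -(a + b) ≤ h ∧ h ≤ √2 * KowalevskiTop.p a b) ∨
            (b ^ 2 * h - b * KowalevskiTop.r a b ^ 2 ≤ g ∧
              g ≤ KowalevskiTop.gMinus a b h ∧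
              √2 * KowalevskiTop.p a b ≤ h) ∨
            (KowalevskiTop.gPlus a b h ≤ g ∧
              g ≤ a ^ 2 * h + a * KowalevskiTop.r a b ^ 2 ∧
              √2 * KowalevskiTop.p a b ≤ h))) ∧
    (∀ h k g : ℝ, √2 * KowalevskiTop.p a b ≤ h →
      KowalevskiTop.gMinus a b h < g → g < KowalevskiTop.gPlus a b h →
      (h, k, g) ∉ KowalevskiTop.surface2 a b ∩ KowalevskiTop.bifurcationDiagram a b) := by
  have hmem : ∀ h k g : ℝ, _ := fun h k g =>
    KowalevskiTop.mem_bifurcationDiagram_iff_systems (a := a) (b := b) (h := h) (k := k) (g := g)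
      hb hab
  refine ⟨fun h k g hJ => ?_, fun h k g => ?_, fun h k g hh h1 h2 hJ => ?_⟩
  · have hpos := KowalevskiTop.sqrt_two_mul_p_nonneg a b
    rcases (hmem h k g hJ.1).1 hJ.2 with h | h | h <;> linarith [h.2.2]
  · exact and_congr_right fun hs => hmem h k g hs
  · rcases (hmem h k g hJ.1).1 hJ.2 with h' | h' | h'
    · -- the two branches meet at `h = √2 p`
      have hh' : h ^ 2 - 2 * KowalevskiTop.p a b ^ 2 = 0 := by
        rw [le_antisymm h'.2.2.2 hh, mul_pow, Real.sq_sqrt zero_le_two, sub_self]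
      rw [KowalevskiTop.gMinus, hh', Real.sqrt_zero, mul_zero, sub_zero] at h1
      rw [KowalevskiTop.gPlus, hh', Real.sqrt_zero, mul_zero, add_zero] at h2
      exact lt_asymm h1 h2
    · linarith [h'.2.1]
    · linarith [h'.1]
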